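/- Let $\{\varepsilon_{\boldsymbol i}\}_{\boldsymbol i\in\mathbb Z^3}$ be a weakly stationary real random field (finite second moments, constant mean, shift-invariant covariances) with $\mathbb E\,\varepsilon_{\boldsymbol i}=0$, on a probability space. Let $\sigma>0$ and let $B$ be a standard Brownian motion (Brownian sheet) on $[0,1]^3$: $B$ is almost surely continuous, vanishes on the faces $\{z_j=0\}$, and its increments over pairwise disjoint blocks $\prod_j(s_j,t_j]\subseteq[0,1]^3$ are independent and centred normal with the volumes of the blocks as variances. For $n=(n_1,n_2,n_3)$ put $$Z_n(v_1,v_2,v_3)=(n_1n_2n_3)^{-1/2}\sum_{i_1=1}^{\lfloor n_1v_1\rfloor}\sum_{i_2=1}^{\lfloor n_2v_2\rfloor}\sum_{i_3=1}^{\lfloor n_3v_3\rfloor}\varepsilon_{i_1,i_2,i_3},\qquad v\in[0,1]^3,$$ and assume that $Z_n\Rightarrow\sigma B$ in the Skorohod space $D[0,1]^3$ as $\min_jn_j\to\infty$. Here, for a box $[a,b]\subset\mathbb R^q$, $D[a,b]$ is the space of real functions on $[a,b]$ that have limits in all $2^q$ quadrants at each point and are continuous from above, with the Skorohod topology, given by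 the distance $\inf_\lambda\max\{\sup_x|g(x)-h(\lambda(x))|,\ \sup_x|\lambda(x)-x|\}$ over all maps $\lambda=(\lambda_1,\dots,\lambda_q)$ with increasing bijections $\lambda_j$ of $[a_j,b_j]$ onto itself, and $\Rightarrow$ is convergence in distribution for the Borel $\sigma$-algebra of this topology. Let $\Omega_1,\Omega_2,\Omega_3>0$ and let $$\varphi(x_1,x_2,x_3)=\prod_{j=1}^3\frac{\sin(\Omega_jx_j)}{\pi x_j}$$ (a factor being $\Omega_j/\pi$ at $x_j=0$). Let $\tau_j=\tau_{j,n_j}>0$, $j=1,2,3$, be sampling periods with $n_j\tau_j\to\overline\tau_j\in\mathbb R$ as $n_j\to\infty$. Let $f,f_0:\mathbb R^3\to\mathbb R$ be a signal and a reference signal, let $y_{l_1,l_2,l_3}=f(l_1\tau_1,l_2\tau_2,l_3\tau_3)+\varepsilon_{l_1,l_2,l_3}$ for $1\le l_j\le n_j$, let $s_0\in(0,1)$, and put $$\mathcal F_n(s,t,r_2,r_3)=\sqrt{\tau_1\tau_2\tau_3}\sum_{l_1=1}^{\lfloor n_1s\rfloor}\sum_{l_2=1}^{n_2}\sum_{l_3=1}^{n_3}\bigl[y_{l_1,l_2,l_3}-f_0(l_1\tau_1,l_2\tau_2,l_3\tau_3)\bigr]\,\varphi(t-l_1\tau_1,r_2-l_2\tau_2,r_3-l_3\tau_3)$$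 for $(s,t,r_2,r_3)\in Q:=[s_0,1]\times[0,\overline\tau_1]\times[0,\overline\tau_2]\times[0,\overline\tau_3]$. Assume the null hypothesis $H_0$: $f=f_0$ on $\prod_j[0,\overline\tau_j]$ and at all sampling points $(l_1\tau_1,l_2\tau_2,l_3\tau_3)$, $1\le l_j\le n_j$ (the latter is automatic when $n_j\tau_j\le\overline\tau_j$ always). Then $$\mathcal F_n\Rightarrow\mathcal F\quad\text{in the Skorohod space } D(Q)\text{ as }\min_jn_j\to\infty,$$ where $$\mathcal F(s,t,r_2,r_3)=\sqrt{\overline\tau_1\overline\tau_2\overline\tau_3}\,\sigma\int_0^s\!\int_0^1\!\int_0^1\varphi(t-\overline\tau_1z_1,r_2-\overline\tau_2z_2,r_3-\overline\tau_3z_3)\,dB(z_1,z_2,z_3).$$ Here the integral is the pathwise multivariate Riemann–Stieltjes integral defined through integration by parts, $$\int_a^b g\,dh:=\sum_{v\subseteq\{1,2,3\}}(-1)^{|v|}\int_{a_v}^{b_v}\bigl[h\,dg\bigr]_{a_{-v}}^{b_{-v}},$$ where $[\cdot]_{a_{-v}}^{b_{-v}}$ is the alternating sum over the corners in the variables outside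 $v$ (the term $v=\emptyset$ is the alternating sum of $hg$ over the corners of $[a,b]$), and each integral with respect to $g$ on the right is the limit of the Riemann–Stieltjes sums, with arbitrary intermediate points, as the mesh tends to $0$. Almost surely, all these limits exist simultaneously for all $(s,t,r_2,r_3)\in Q$. -/

import Mathlib

open MeasureTheory ProbabilityTheory Filter Topology

/-! ### The Skorohod space on a box -/

/-- The compact box `∏ j, [a j, b j]` in `ℝ^q`. -/
abbrev RBox {q : ℕ} (a b : Fin q → ℝ) : Type := ∀ j, Set.Icc (a j) (b j)

/-- A point of the box as a vector of `ℝ^q`. -/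
def RBox.vec {q : ℕ} {a b : Fin q → ℝ} (x : RBox a b) : Fin q → ℝ := fun j => (x j : ℝ)

/-- The quadrant with vertex `t` inside the box: the coordinates in `R` satisfy `s p < t p`, the
other ones satisfy `t p ≤ s p`. -/
def quadrant {q : ℕ} {a b : Fin q → ℝ} (t : RBox a b) (R : Finset (Fin q)) : Set (RBox a b) :=
  {s | ∀ p, (p ∈ R → s p < t p) ∧ (p ∉ R → t p ≤ s p)}

/-- `f` is continuous from above with limits from below: it has a limit in each of the `2^q`
quadrants at every point (nothing is required for a quadrant that does not accumulate at the
point), and its value is the limit in the quadrant given by `≥` in all coordinates. -/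
structure IsLamp {q : ℕ} {a b : Fin q → ℝ} (f : RBox a b → ℝ) : Prop where
  exists_limit : ∀ (t : RBox a b) (R : Finset (Fin q)), ∃ L : ℝ,
    Tendsto f (𝓝[quadrant t R] t) (𝓝 L)
  limit_above : ∀ t : RBox a b, Tendsto f (𝓝[quadrant t ∅] t) (𝓝 (f t))

/-- The Skorohod space `D(∏ j, [a j, b j])`. -/
def SkorohodSpace {q : ℕ} (a b : Fin q → ℝ) : Type := {f : RBox a b → ℝ // IsLamp f}

/-- A change of scale: in every coordinate an increasing bijection of `[a j, b j]` onto itself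
(such a map is automatically a homeomorphism that fixes the end points). -/
abbrev ScaleChange {q : ℕ} (a b : Fin q → ℝ) : Type :=
  ∀ j, Set.Icc (a j) (b j) ≃o Set.Icc (a j) (b j)

/-- The coordinatewise action of a change of scale on the box. -/
def ScaleChange.act {q : ℕ} {a b : Fin q → ℝ} (lam : ScaleChange a b) (x : RBox a b) :
    RBox a b := fun j => lam j (x j)

/-- The larger one of `sup |f - g ∘ λ|` and `sup |λ - id|`. -/
noncomputable def skorohodCost {q : ℕ} {a b : Fin q → ℝ} (f g : RBox a b → ℝ)
    (lam : ScaleChange a b) : ENNReal :=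
  max (⨆ x, edist (f x) (g (lam.act x))) (⨆ x, edist (lam.act x) x)

/-- The Skorohod distance: the infimum of the cost over all changes of scale. -/
noncomputable def skorohodEDist {q : ℕ} {a b : Fin q → ℝ} (f g : RBox a b → ℝ) : ENNReal :=
  ⨅ lam : ScaleChange a b, skorohodCost f g lam

theorem skorohodEDist_self {q : ℕ} {a b : Fin q → ℝ} (f : RBox a b → ℝ) :
    skorohodEDist f f = 0 := by
  refine le_antisymm ((iInf_le _ (fun j => OrderIso.refl _)).trans ?_) (by simp)
  have h : ∀ x : RBox a b,
      ScaleChange.act (fun j => OrderIso.refl (Set.Icc (a j) (b j))) x = x := fun x => rfl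
  simp [skorohodCost, h]

theorem skorohodEDist_comm_le {q : ℕ} {a b : Fin q → ℝ} (f g : RBox a b → ℝ) :
    skorohodEDist g f ≤ skorohodEDist f g := by
  refine le_iInf fun lam => (iInf_le _ (fun j => (lam j).symm)).trans ?_
  have h : ∀ x : RBox a b, lam.act (ScaleChange.act (fun j => (lam j).symm) x) = x :=
    fun x => funext fun j => by simp [ScaleChange.act]
  refine max_le_max (iSup_le fun x => ?_) (iSup_le fun x => ?_)
  · refine le_trans (le_of_eq ?_)
      (le_iSup (fun y => edist (f y) (g (lam.act y))) (ScaleChange.act (fun j => (lam j).symm) x))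
    rw [h, edist_comm]
  · refine le_trans (le_of_eq ?_)
      (le_iSup (fun y => edist (lam.act y) y) (ScaleChange.act (fun j => (lam j).symm) x))
    rw [h, edist_comm]

theorem skorohodEDist_triangle {q : ℕ} {a b : Fin q → ℝ} (f g h : RBox a b → ℝ) :
    skorohodEDist f h ≤ skorohodEDist f g + skorohodEDist g h := by
  refine ENNReal.le_iInf_add_iInf fun lam mu => ?_
  refine (iInf_le _ (fun j => (lam j).trans (mu j))).trans ?_
  have hc : ∀ x : RBox a b,
      ScaleChange.act (fun j => (lam j).trans (mu j)) x = mu.act (lam.act x) := fun x => rfl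
  refine max_le (iSup_le fun x => ?_) (iSup_le fun x => ?_)
  · rw [hc]
    refine (edist_triangle _ (g (lam.act x)) _).trans (add_le_add ?_ ?_)
    · exact (le_iSup (fun y => edist (f y) (g (lam.act y))) x).trans (le_max_left _ _)
    · exact (le_iSup (fun y => edist (g y) (h (mu.act y))) (lam.act x)).trans (le_max_left _ _)
  · rw [hc, add_comm]
    refine (edist_triangle _ (lam.act x) _).trans (add_le_add ?_ ?_)
    · exact (le_iSup (fun y => edist (mu.act y) y) (lam.act x)).trans (le_max_right _ _)
    · exact (le_iSup (fun y => edist (lam.act y) y) x).trans (le_max_right _ _)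

/-- The Skorohod distance and its topology on `D(∏ j, [a j, b j])`. -/
noncomputable instance SkorohodSpace.instPseudoEMetricSpace {q : ℕ} (a b : Fin q → ℝ) :
    PseudoEMetricSpace (SkorohodSpace a b) where
  edist f g := skorohodEDist f.1 g.1
  edist_self f := skorohodEDist_self f.1
  edist_comm f g := le_antisymm (skorohodEDist_comm_le g.1 f.1) (skorohodEDist_comm_le f.1 g.1)
  edist_triangle f g h := skorohodEDist_triangle f.1 g.1 h.1

/-- The Borel sigma-algebra of the Skorohod topology. -/
noncomputable instance SkorohodSpace.instMeasurableSpace {q : ℕ} (a b : Fin q → ℝ) :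
    MeasurableSpace (SkorohodSpace a b) := borel _

instance SkorohodSpace.instBorelSpace {q : ℕ} (a b : Fin q → ℝ) :
    BorelSpace (SkorohodSpace a b) := ⟨rfl⟩

/-- Weak convergence `X i ⇒ Z` along `l` in the Skorohod space `D(∏ j, [a j, b j])` of processes
that are indexed by `ℝ^q` and looked at on the box only: every path of `X i` and almost every path
of `Z` lies in the Skorohod space, and the random elements of the Skorohod space so obtained
converge in distribution (which contains their measurability). -/
def SkorohodWeakConv {I Ω Ω' : Type*} [MeasurableSpace Ω] [MeasurableSpace Ω'] {q : ℕ}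
    (a b : Fin q → ℝ) (X : I → (Fin q → ℝ) → Ω → ℝ) (l : Filter I) (Z : (Fin q → ℝ) → Ω' → ℝ)
    (P : Measure Ω) (P' : Measure Ω') [IsProbabilityMeasure P] [IsProbabilityMeasure P'] : Prop :=
  ∃ (X' : I → Ω → SkorohodSpace a b) (Z' : Ω' → SkorohodSpace a b),
    (∀ i ω x, (X' i ω).1 x = X i (RBox.vec x) ω) ∧
    (∀ᵐ ω ∂P', ∀ x, (Z' ω).1 x = Z (RBox.vec x) ω) ∧
    TendstoInDistribution X' l Z' (fun _ => P) P'

/-! ### Alternating sums and Brownian motion with several parameters -/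

/-- The alternating sum `Δ(f; a, b) = ∑_{v} (-1)^|v| f(a_v : b_{-v})` of `f` over the box with
corners `a` and `b`. -/
def altSum {ι : Type*} [Fintype ι] [DecidableEq ι] (f : (ι → ℝ) → ℝ) (a b : ι → ℝ) : ℝ :=
  ∑ v : Finset ι, (-1) ^ v.card * f (v.piecewise a b)

/-- The block `∏ j, (s j, t j]`. -/
def block {q : ℕ} (s t : Fin q → ℝ) : Set (Fin q → ℝ) :=
  Set.univ.pi fun j => Set.Ioc (s j) (t j)

/-- `B` (of which only the values on `[0,1]^q` matter) is a standard Brownian motion on `[0,1]^q`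
under `P`, also called Brownian sheet: it is almost surely continuous, it vanishes on the lower
faces of the cube, and its increments around pairwise disjoint blocks are independent and centred
normal, with the volumes of the blocks as variances. -/
structure IsBrownianSheet {Ω : Type*} [MeasurableSpace Ω] {q : ℕ}
    (B : (Fin q → ℝ) → Ω → ℝ) (P : Measure Ω) : Prop where
  aemeasurable : ∀ t ∈ Set.Icc (0 : Fin q → ℝ) 1, AEMeasurable (B t) P
  continuousOn : ∀ᵐ ω ∂P, ContinuousOn (fun t => B t ω) (Set.Icc 0 1)
  eq_zero : ∀ᵐ ω ∂P, ∀ t ∈ Set.Icc (0 : Fin q → ℝ) 1, (∃ j, t j = 0) → B t ω = 0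
  increments : ∀ (k : ℕ) (s t : Fin k → Fin q → ℝ),
    (∀ i, 0 ≤ s i ∧ s i ≤ t i ∧ t i ≤ 1) →
    (Pairwise fun i i' => Disjoint (block (s i) (t i)) (block (s i') (t i'))) →
      iIndepFun (fun i ω => altSum (fun z => B z ω) (s i) (t i)) P ∧
      ∀ i, HasLaw (fun ω => altSum (fun z => B z ω) (s i) (t i))
        (gaussianReal 0 (volume (block (s i) (t i))).toNNReal) P

/-! ### The multivariate Riemann-Stieltjes integral -/

/-- A ladder on the box with corners `a` and `b`: in every coordinate a partition
`a j = pt j 0 ≤ pt j 1 ≤ ... ≤ pt j (size j) = b j`. (Repeated points are harmless: the alternating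
sum over a degenerate cell is zero.) -/
structure Ladder {ι : Type*} (a b : ι → ℝ) where
  size : ι → ℕ
  pt : ι → ℕ → ℝ
  mono : ∀ j, Monotone (pt j)
  first : ∀ j, pt j 0 = a j
  last : ∀ j, pt j (size j) = b j

namespace Ladder

/-- The indices of the cells of a ladder. -/
def cells {ι : Type*} [Fintype ι] [DecidableEq ι] {a b : ι → ℝ} (Y : Ladder a b) :
    Finset (ι → ℕ) := Fintype.piFinset fun j => Finset.range (Y.size j)

/-- The lower corner of a cell. -/
def lower {ι : Type*} {a b : ι → ℝ} (Y : Ladder a b) (k : ι → ℕ) : ι → ℝ :=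
  fun j => Y.pt j (k j)

/-- The upper corner of a cell. -/
def upper {ι : Type*} {a b : ι → ℝ} (Y : Ladder a b) (k : ι → ℕ) : ι → ℝ :=
  fun j => Y.pt j (k j + 1)

/-- All edges of all cells are shorter than `δ`. -/
def MeshLT {ι : Type*} {a b : ι → ℝ} (Y : Ladder a b) (δ : ℝ) : Prop :=
  ∀ j, ∀ i < Y.size j, Y.pt j (i + 1) - Y.pt j i < δ

end Ladder

/-- The Riemann-Stieltjes sums `∑ h(tag) Δ(f; y, y⁺)`, with one arbitrary point `tag` in each closed
cell `[y, y⁺]`, converge to `I` as the mesh of the ladder on the box with corners `a`, `b` tends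
to zero, i.e. `∫_a^b h df = I`. In dimension zero this says that `I` is the product of the values
of `h` and `f` at the only point. -/
def HasRSIntegral {ι : Type*} [Fintype ι] [DecidableEq ι] (h f : (ι → ℝ) → ℝ) (a b : ι → ℝ)
    (I : ℝ) : Prop :=
  ∀ ε > 0, ∃ δ > 0, ∀ Y : Ladder a b, Y.MeshLT δ → ∀ tag : (ι → ℕ) → ι → ℝ,
    (∀ k ∈ Y.cells, tag k ∈ Set.Icc (Y.lower k) (Y.upper k)) →
      |∑ k ∈ Y.cells, h (tag k) * altSum f (Y.lower k) (Y.upper k) - I| < ε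

open Classical in
/-- The Riemann-Stieltjes integral `∫_a^b h df` (zero if it does not exist). -/
noncomputable def rsIntegral {ι : Type*} [Fintype ι] [DecidableEq ι] (h f : (ι → ℝ) → ℝ)
    (a b : ι → ℝ) : ℝ :=
  if H : ∃ I, HasRSIntegral h f a b I then H.choose else 0

/-- The point `x_v : a_w : b_{-(v ∪ w)}`. -/
def glue {q : ℕ} (a b : Fin q → ℝ) (v w : Finset (Fin q)) (x : v → ℝ) : Fin q → ℝ :=
  fun j => if hj : j ∈ v then x ⟨j, hj⟩ else if j ∈ w then a j else b j

/-- The integral `∫_{a_v}^{b_v} h df` in the variables in `v`, where in both functions the variables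
in `w` are fixed at `a` and all others at `b`, exists. -/
def FaceIntegrable {q : ℕ} (h f : (Fin q → ℝ) → ℝ) (a b : Fin q → ℝ) (v w : Finset (Fin q)) :
    Prop :=
  ∃ I, HasRSIntegral (fun x => h (glue a b v w x)) (fun x => f (glue a b v w x))
    (fun j : v => a j) (fun j : v => b j) I

/-- The value of the integral in `FaceIntegrable`. -/
noncomputable def faceIntegral {q : ℕ} (h f : (Fin q → ℝ) → ℝ) (a b : Fin q → ℝ)
    (v w : Finset (Fin q)) : ℝ :=
  rsIntegral (fun x => h (glue a b v w x)) (fun x => f (glue a b v w x))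
    (fun j : v => a j) (fun j : v => b j)

/-- All integrals on the right-hand side of the integration by parts formula for `∫_a^b f dh`
exist. -/
def ByPartsIntegrable {q : ℕ} (f h : (Fin q → ℝ) → ℝ) (a b : Fin q → ℝ) : Prop :=
  ∀ v : Finset (Fin q), ∀ w ⊆ vᶜ, FaceIntegrable h f a b v w

/-- The multivariate Riemann-Stieltjes integral `∫_a^b f dh` with respect to a function `h` that
need not have bounded variation, defined through integration by parts as
`∑_{v} (-1)^|v| ∫_{a_v}^{b_v} [h df]_{a_{-v}}^{b_{-v}}`, where the bracket is
the alternating sum over the subsets `w` of the complement of `v`. The term `v = ∅` is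
the alternating sum of `h f` over the box, the term of the full set is `(-1)^q ∫_a^b h df`. -/
noncomputable def byPartsIntegral {q : ℕ} (f h : (Fin q → ℝ) → ℝ) (a b : Fin q → ℝ) : ℝ :=
  ∑ v : Finset (Fin q), (-1) ^ v.card *
    ∑ w ∈ vᶜ.powerset, (-1) ^ w.card * faceIntegral h f a b v w

/-! ### The noise field, the sampling model and the detector process -/

/-- Weak stationarity of a random field on `ℤ^3`: finite second moments, constant mean and
shift invariant covariances. -/
structure IsWeaklyStationary {Ω : Type*} [MeasurableSpace Ω] (e : (Fin 3 → ℤ) → Ω → ℝ)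
    (P : Measure Ω) : Prop where
  memLp : ∀ i, MemLp (e i) 2 P
  mean : ∀ i j, ∫ ω, e i ω ∂P = ∫ ω, e j ω ∂P
  cov : ∀ i j k, covariance (e (i + k)) (e (j + k)) P = covariance (e i) (e j) P

/-- The partial sum field
`Z_n(v) = (n₁ n₂ n₃)^(-1/2) ∑_{i₁ ≤ ⌊n₁ v₁⌋} ∑_{i₂ ≤ ⌊n₂ v₂⌋} ∑_{i₃ ≤ ⌊n₃ v₃⌋} e_{i₁, i₂, i₃}`,
the summation indices starting from 1. -/
noncomputable def partialSumField {Ω : Type*} (e : (Fin 3 → ℤ) → Ω → ℝ) (n : Fin 3 → ℕ)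
    (v : Fin 3 → ℝ) (ω : Ω) : ℝ :=
  (√(∏ j, (n j : ℝ)))⁻¹ *
    ∑ i ∈ Finset.Icc (1 : Fin 3 → ℕ) (fun j => ⌊(n j : ℝ) * v j⌋₊), e (fun j => (i j : ℤ)) ω

/-- The functional central limit theorem assumption on the noise: the field is weakly stationary and
centred, and its partial sum field converges weakly to `σ B` in `D[0,1]^3` as `min n_j → ∞` (which
is the filter `atTop` of the product order on the sample sizes). -/
structure NoiseFCLT {Ω Ω' : Type*} [MeasurableSpace Ω] [MeasurableSpace Ω']
    (e : (Fin 3 → ℤ) → Ω → ℝ) (σ : ℝ) (B : (Fin 3 → ℝ) → Ω' → ℝ) (P : Measure Ω) (P' : Measure Ω')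
    [IsProbabilityMeasure P] [IsProbabilityMeasure P'] : Prop where
  stationary : IsWeaklyStationary e P
  centred : ∀ i, ∫ ω, e i ω ∂P = 0
  weakConv : SkorohodWeakConv (0 : Fin 3 → ℝ) 1 (partialSumField e) atTop
    (fun v ω => σ * B v ω) P P'

/-- The product reconstruction kernel `φ(x) = ∏ j, sin (Ω_j x_j) / (π x_j)`, where a factor is read
as `Ω_j / π` at `x_j = 0`. -/
noncomputable def reconKernel (W : Fin 3 → ℝ) (x : Fin 3 → ℝ) : ℝ :=
  ∏ j, (W j / Real.pi) * Real.sinc (W j * x j)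

/-- The sampling point `(l₁ τ₁, l₂ τ₂, l₃ τ₃)`, where the sampling period `τ j (n j)` in
direction `j` depends on the sample size `n j`. -/
def samplePoint (τ : Fin 3 → ℕ → ℝ) (n l : Fin 3 → ℕ) : Fin 3 → ℝ :=
  fun j => (l j : ℝ) * τ j (n j)

/-- The noisy sample `y_l = f(l₁ τ₁, l₂ τ₂, l₃ τ₃) + e_l`. -/
def observation {Ω : Type*} (f : (Fin 3 → ℝ) → ℝ) (e : (Fin 3 → ℤ) → Ω → ℝ) (τ : Fin 3 → ℕ → ℝ)
    (n l : Fin 3 → ℕ) (ω : Ω) : ℝ :=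
  f (samplePoint τ n l) + e (fun j => (l j : ℤ)) ω

/-- The null hypothesis of no change: the signal `f` agrees with the reference signal `f₀` on
`∏ j, [0, τbar j]` and at all sampling points (those may lie outside the box
if `n j * τ j (n j) > τbar j`). -/
def NullHypothesis (f f₀ : (Fin 3 → ℝ) → ℝ) (τ : Fin 3 → ℕ → ℝ) (τbar : Fin 3 → ℝ) : Prop :=
  (∀ x ∈ Set.Icc 0 τbar, f x = f₀ x) ∧
  ∀ n, ∀ l ∈ Finset.Icc (1 : Fin 3 → ℕ) n, f (samplePoint τ n l) = f₀ (samplePoint τ n l)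

/-- The sequential detector process `F_n(s, t, r₂, r₃)` at `u = (s, t, r₂, r₃)`, computed from the
samples `y`: the square root of `τ₁ τ₂ τ₃` times the sum, over `1 ≤ l₁ ≤ ⌊n₁ s⌋`, `1 ≤ l₂ ≤ n₂` and
`1 ≤ l₃ ≤ n₃`, of `(y_l - f₀(l₁ τ₁, l₂ τ₂, l₃ τ₃)) φ(t - l₁ τ₁, r₂ - l₂ τ₂, r₃ - l₃ τ₃)`. -/
noncomputable def detector {Ω : Type*} (W : Fin 3 → ℝ) (τ : Fin 3 → ℕ → ℝ)
    (f₀ : (Fin 3 → ℝ) → ℝ) (y : (Fin 3 → ℕ) → (Fin 3 → ℕ) → Ω → ℝ)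
    (n : Fin 3 → ℕ) (u : Fin 4 → ℝ) (ω : Ω) : ℝ :=
  √(∏ j, τ j (n j)) *
    ∑ l ∈ Finset.Icc (1 : Fin 3 → ℕ) (Function.update n 0 ⌊(n 0 : ℝ) * u 0⌋₊),
      (y n l ω - f₀ (samplePoint τ n l)) *
        reconKernel W (fun j => u j.succ - samplePoint τ n l j)

/-- The integrand `z ↦ φ(t - τbar₁ z₁, r₂ - τbar₂ z₂, r₃ - τbar₃ z₃)` for
`u = (s, t, r₂, r₃)`. -/
noncomputable def limitIntegrand (W τbar : Fin 3 → ℝ) (u : Fin 4 → ℝ) (z : Fin 3 → ℝ) : ℝ :=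
  reconKernel W (fun j => u j.succ - τbar j * z j)

/-- The corner `(s, 1, 1)` of the domain of integration, for `u = (s, t, r₂, r₃)`. -/
def upperCorner (u : Fin 4 → ℝ) : Fin 3 → ℝ := Function.update 1 0 (u 0)

/-- The limit process `F(s, t, r₂, r₃)`, for `u = (s, t, r₂, r₃)`: the square root of
`τbar₁ τbar₂ τbar₃` times `σ` times
`∫_0^s ∫_0^1 ∫_0^1 φ(t - τbar₁ z₁, r₂ - τbar₂ z₂, r₃ - τbar₃ z₃) dB(z)`. -/
noncomputable def limitProcess {Ω' : Type*} (W τbar : Fin 3 → ℝ) (σ : ℝ)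
    (B : (Fin 3 → ℝ) → Ω' → ℝ) (u : Fin 4 → ℝ) (ω : Ω') : ℝ :=
  √(∏ j, τbar j) * σ *
    byPartsIntegral (limitIntegrand W τbar u) (fun z => B z ω) 0 (upperCorner u)

/-! Under the null hypothesis the detector is a deterministic linear functional of the noise array.
Abel summation in all three variables (`sum_mul_prod_eq_sum_arraySum`) turns it into a signed sum,
over the subsets `v` of the coordinates, of Riemann–Stieltjes sums of the partial sum field against
increments of the product kernel. Integration by parts gives the limit the same shape: the kernel is
smooth, so each term is a Lebesgue integral of the Brownian path against a mixed partial derivative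
of the kernel (`byPartsIntegral_limitIntegrand`).

The heart is a pathwise estimate, `eventually_abs_arrayDetector_sub_le`: if the partial sum field of
an array is uniformly close to a continuous `z`, then for large `n` its detector is close to the
limit functional of `z`, uniformly in `u`. Almost every path of `σ B` is continuous, and Skorohod
closeness to a continuous path is uniform closeness (`SkorohodSpace.exists_edist_lt_imp`). The
estimate therefore supplies exactly the local condition of
`tendstoInDistribution_of_eventually_mem`, a continuous mapping theorem for maps that vary with `n`,
proved by the open-set portmanteau criterion without passing to almost surely convergent copies.

The limit also has to be a random element of the Skorohod space. The same estimate is applied to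
arrays manufactured from `B` (`gridArray`), whose partial sums are the values of `σ B` at grid
points. Their detector paths are finite linear combinations of fixed paths with measurable
coefficients and converge uniformly to the limit, which yields both its path regularity and its
measurability. -/

/-- An extended continuous mapping theorem: if `X i ⇒ Z` and `Y i` is close to `V` whenever
`X i` is close to `Z`, then `Y i ⇒ V`. -/
theorem tendstoInDistribution_of_eventually_mem {I Ω Ω' S S' : Type*} [MeasurableSpace Ω]
    [MeasurableSpace Ω'] [TopologicalSpace S] [MeasurableSpace S] [OpensMeasurableSpace S]
    [HasOuterApproxClosed S] [PseudoEMetricSpace S'] [MeasurableSpace S'] [BorelSpace S']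
    {P : Measure Ω} [IsProbabilityMeasure P] {P' : Measure Ω'} [IsProbabilityMeasure P']
    {l : Filter I} [l.IsCountablyGenerated] {X : I → Ω → S} {Z : Ω' → S} {Y : I → Ω → S'}
    {V : Ω' → S'} (hX : TendstoInDistribution X l Z (fun _ => P) P')
    (hY : ∀ i, AEMeasurable (Y i) P) (hV : AEMeasurable V P')
    (h : ∀ᵐ ω' ∂P', ∀ G, IsOpen G → V ω' ∈ G → ∃ U, IsOpen U ∧ Z ω' ∈ U ∧
      ∀ᶠ i in l, ∀ ω, X i ω ∈ U → Y i ω ∈ G) :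
    TendstoInDistribution Y l V (fun _ => P) P' := by
  refine ⟨hY, hV, tendsto_of_forall_isOpen_le_liminf' fun G hG => ?_⟩
  obtain ⟨b, hb⟩ := l.exists_antitone_basis
  -- `U m` is the largest open set that forces `Y i` into `G` for all `i ∈ b m`. Taking the union
  -- avoids selecting a neighbourhood for each `ω'`, and `U m` increases with `m`.
  let A : ℕ → Set (Set S) := fun m => {U | IsOpen U ∧ ∀ i ∈ b m, ∀ ω, X i ω ∈ U → Y i ω ∈ G}
  let U : ℕ → Set S := fun m => ⋃₀ A m
  have hUo : ∀ m, IsOpen (U m) := fun m => isOpen_sUnion fun _ hs => hs.1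
  have hmono : Monotone U := fun m m' hm => Set.sUnion_subset_sUnion fun s hs =>
    ⟨hs.1, fun i hi => hs.2 i (hb.antitone hm hi)⟩
  have hlim : ∀ m, P'.map Z (U m) ≤ l.liminf fun i => P.map (Y i) G := by
    intro m
    refine (ProbabilityMeasure.le_liminf_measure_open_of_tendsto hX.tendsto (hUo m)).trans ?_
    refine liminf_le_liminf ?_
    filter_upwards [hb.mem m] with i hi
    simp only [ProbabilityMeasure.coe_mk]
    rw [Measure.map_apply_of_aemeasurable (hX.forall_aemeasurable i) (hUo m).measurableSet,
      Measure.map_apply_of_aemeasurable (hY i) hG.measurableSet]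
    refine measure_mono ?_
    rintro ω ⟨s, hs, hω⟩
    exact hs.2 i hi ω hω
  have hsup : P'.map V G ≤ P'.map Z (⋃ m, U m) := by
    rw [Measure.map_apply_of_aemeasurable hV hG.measurableSet,
      Measure.map_apply_of_aemeasurable hX.aemeasurable_limit
        (isOpen_iUnion hUo).measurableSet]
    refine measure_mono_ae ?_
    filter_upwards [h] with ω hω hG'
    obtain ⟨s, hs, hZs, hev⟩ := hω G hG hG'
    obtain ⟨m, -, hm⟩ := hb.1.mem_iff.1 hev
    exact Set.mem_iUnion.2 ⟨m, s, ⟨hs, fun i hi => hm hi⟩, hZs⟩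
  refine hsup.trans ?_
  -- Continuity from below turns the bound for each `m` into one for the union.
  rw [hmono.measure_iUnion]
  exact iSup_le hlim

/-! ### Skorohod distance and uniform distance. -/

namespace SkorohodSpace

variable {q : ℕ} {a b : Fin q → ℝ}

theorem edist_le_of_forall {f g : SkorohodSpace a b} {r : ENNReal}
    (h : ∀ x, edist (f.1 x) (g.1 x) ≤ r) : edist f g ≤ r := by
  refine (iInf_le _ (fun j => OrderIso.refl _)).trans ?_
  have hid : ∀ x : RBox a b,
      ScaleChange.act (fun j => OrderIso.refl (Set.Icc (a j) (b j))) x = x := fun x => rfl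
  simpa [skorohodCost, hid] using h

/-- Skorohod neighbourhoods of a uniformly continuous function are uniform neighbourhoods. -/
theorem exists_edist_lt_imp {z : SkorohodSpace a b} (hz : UniformContinuous z.1) {ε : ℝ}
    (hε : 0 < ε) : ∃ δ > 0, ∀ f : SkorohodSpace a b, edist f z < δ →
      ∀ x, dist (f.1 x) (z.1 x) < ε := by
  obtain ⟨η, hη, hzη⟩ := Metric.uniformContinuous_iff.1 hz (ε / 2) (half_pos hε)
  -- The bound `η` controls the displacement of the argument, which moves `z` by less than `ε / 2`;
  -- the bound `ε / 2` controls the difference of the values.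
  refine ⟨ENNReal.ofReal (min η (ε / 2)), by simp [hη, hε], fun f hf x => ?_⟩
  obtain ⟨lam, hlam⟩ := iInf_lt_iff.1 (show skorohodEDist f.1 z.1 < _ from hf)
  have h1 : edist (f.1 x) (z.1 (lam.act x)) < ENNReal.ofReal (min η (ε / 2)) :=
    ((le_iSup (fun y => edist (f.1 y) (z.1 (lam.act y))) x).trans (le_max_left _ _)).trans_lt hlam
  have h2 : edist (lam.act x) x < ENNReal.ofReal (min η (ε / 2)) :=
    ((le_iSup (fun y => edist (lam.act y) y) x).trans (le_max_right _ _)).trans_lt hlam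
  rw [edist_lt_ofReal] at h1 h2
  have h3 := hzη (h2.trans_le (min_le_left _ _))
  have h4 := h1.trans_le (min_le_right _ _)
  calc dist (f.1 x) (z.1 x) ≤ dist (f.1 x) (z.1 (lam.act x)) + dist (z.1 (lam.act x)) (z.1 x) :=
        dist_triangle _ _ _
    _ < ε / 2 + ε / 2 := add_lt_add h4 h3
    _ = ε := add_halves ε

end SkorohodSpace

/-! ### Closure properties of `IsLamp`. -/

namespace IsLamp

variable {q : ℕ} {a b : Fin q → ℝ}

theorem of_continuous {f : RBox a b → ℝ} (hf : Continuous f) : IsLamp f :=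
  ⟨fun t _ => ⟨f t, hf.continuousAt.mono_left nhdsWithin_le_nhds⟩,
    fun _ => hf.continuousAt.mono_left nhdsWithin_le_nhds⟩

theorem const_mul {f : RBox a b → ℝ} (hf : IsLamp f) (c : ℝ) : IsLamp fun x => c * f x := by
  refine ⟨fun t R => ?_, fun t => (hf.limit_above t).const_mul c⟩
  obtain ⟨L, hL⟩ := hf.exists_limit t R
  exact ⟨c * L, hL.const_mul c⟩

theorem sum {ι : Type*} (s : Finset ι) {f : ι → RBox a b → ℝ} (hf : ∀ i, IsLamp (f i)) :
    IsLamp fun x => ∑ i ∈ s, f i x := by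
  refine ⟨fun t R => ?_, fun t => tendsto_finsetSum _ fun i _ => (hf i).limit_above t⟩
  choose L hL using fun i => (hf i).exists_limit t R
  exact ⟨∑ i ∈ s, L i, tendsto_finsetSum _ fun i _ => hL i⟩

/-- Jumps upwards in one coordinate of a continuous function. -/
theorem indicator {f : RBox a b → ℝ} (hf : Continuous f) (j : Fin q) (c : ℝ) :
    IsLamp fun x => if c ≤ (x j : ℝ) then f x else 0 := by
  have hc : Continuous fun x : RBox a b => (x j : ℝ) := by fun_prop
  have hlim : ∀ t R, Tendsto f (𝓝[quadrant t R] t) (𝓝 (f t)) :=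
    fun t R => hf.continuousAt.mono_left nhdsWithin_le_nhds
  have hbelow : ∀ (t : RBox a b) R, (t j : ℝ) < c →
      Tendsto (fun x : RBox a b => if c ≤ (x j : ℝ) then f x else 0) (𝓝[quadrant t R] t)
        (𝓝 0) := by
    intro t R h
    refine tendsto_const_nhds.congr' (nhdsWithin_le_nhds ?_)
    filter_upwards [hc.continuousAt.eventually_lt_const h] with x hx
    rw [if_neg hx.not_ge]
  have habove : ∀ (t : RBox a b) R, j ∉ R → c ≤ (t j : ℝ) →
      Tendsto (fun x : RBox a b => if c ≤ (x j : ℝ) then f x else 0) (𝓝[quadrant t R] t)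
        (𝓝 (f t)) := by
    intro t R hj h
    refine (hlim t R).congr' ?_
    filter_upwards [self_mem_nhdsWithin] with x hx
    exact (if_pos (h.trans ((hx j).2 hj))).symm
  refine ⟨fun t R => ?_, fun t => ?_⟩
  · rcases lt_trichotomy (t j : ℝ) c with h | h | h
    · exact ⟨0, hbelow t R h⟩
    -- At the jump the quadrant decides: approached from strictly below in direction `j` the limit
    -- is `0`, otherwise it is `f t`. The non-strict `c ≤ x j` is what gives continuity from above.
    · by_cases hj : j ∈ R
      · refine ⟨0, tendsto_const_nhds.congr' ?_⟩
        filter_upwards [self_mem_nhdsWithin] with x hx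
        have : (x j : ℝ) < t j := (hx j).1 hj
        exact (if_neg (by linarith)).symm
      · exact ⟨f t, habove t R hj h.ge⟩
    · refine ⟨f t, (hlim t R).congr' (nhdsWithin_le_nhds ?_)⟩
      filter_upwards [hc.continuousAt.eventually_const_lt h] with x hx
      exact (if_pos hx.le).symm
  · split_ifs with h
    · exact habove t ∅ (by simp) h
    · exact hbelow t ∅ (not_le.1 h)

/-- Uniform approximation makes the image filters Cauchy, and completeness of `ℝ` supplies the
quadrant limits. This is how the limit process gets its path regularity. -/
theorem of_uniform_limit {f : RBox a b → ℝ}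
    (h : ∀ ε > 0, ∃ g : RBox a b → ℝ, IsLamp g ∧ ∀ x, dist (f x) (g x) ≤ ε) : IsLamp f := by
  refine ⟨fun t R => ?_, fun t => ?_⟩
  · rcases eq_or_neBot (𝓝[quadrant t R] t) with hb | hb
    · exact ⟨0, by rw [hb]; exact tendsto_bot⟩
    refine cauchy_map_iff_exists_tendsto.1 (Metric.cauchy_iff.2 ⟨hb.map f, fun ε hε => ?_⟩)
    obtain ⟨g, hg, hfg⟩ := h (ε / 4) (by positivity)
    obtain ⟨L, hL⟩ := hg.exists_limit t R
    refine ⟨f '' (g ⁻¹' Metric.ball L (ε / 4)),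
      image_mem_map (hL (Metric.ball_mem_nhds L (by positivity))), ?_⟩
    rintro _ ⟨x, hx, rfl⟩ _ ⟨y, hy, rfl⟩
    have h1 := hfg x
    have h2 := hfg y
    rw [Set.mem_preimage, Metric.mem_ball, Real.dist_eq, abs_lt] at hx hy
    rw [Real.dist_eq, abs_le] at h1 h2
    rw [Real.dist_eq, abs_lt]
    constructor <;> linarith [hx.1, hx.2, hy.1, hy.2, h1.1, h1.2, h2.1, h2.2]
  · refine Metric.tendsto_nhds.2 fun ε hε => ?_
    obtain ⟨g, hg, hfg⟩ := h (ε / 4) (by positivity)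
    filter_upwards [Metric.tendsto_nhds.1 (hg.limit_above t) (ε / 4) (by positivity)] with x hx
    have h1 := hfg x
    have h2 := hfg t
    rw [Real.dist_eq, abs_lt] at hx
    rw [Real.dist_eq, abs_le] at h1 h2
    rw [Real.dist_eq, abs_lt]
    constructor <;> linarith [hx.1, hx.2, h1.1, h1.2, h2.1, h2.2]

end IsLamp

/-! ### Measurability of random linear combinations of fixed paths. -/

namespace SkorohodSpace

variable {q : ℕ} {a b : Fin q → ℝ}

/-- Finite linear combinations in the Skorohod space. -/
noncomputable def linearComb {ι : Type*} [Fintype ι] (g : ι → RBox a b → ℝ)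
    (hg : ∀ i, IsLamp (g i)) (c : ι → ℝ) : SkorohodSpace a b :=
  ⟨fun x => ∑ i, c i * g i x, IsLamp.sum _ fun i => (hg i).const_mul (c i)⟩

/-- The uniform distance of two combinations is at most `∑ |c' i - c i| * M i`. Borel measurability
of a path-valued map is thereby reduced to that of finitely many real coefficients. -/
theorem continuous_linearComb {ι : Type*} [Fintype ι] (g : ι → RBox a b → ℝ)
    (hg : ∀ i, IsLamp (g i)) (hbdd : ∀ i, ∃ M, ∀ x, |g i x| ≤ M) :
    Continuous (linearComb g hg) := by
  choose M hM using hbdd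
  refine continuous_iff_continuousAt.2 fun c => ?_
  rw [ContinuousAt, EMetric.tendsto_nhds]
  intro ε hε
  have hlim : Tendsto (fun c' : ι → ℝ => ENNReal.ofReal (∑ i, |c' i - c i| * M i)) (𝓝 c)
      (𝓝 (ENNReal.ofReal (∑ i, |c i - c i| * M i))) := by
    exact Continuous.tendsto (ENNReal.continuous_ofReal.comp (by fun_prop)) c
  simp only [sub_self, abs_zero, zero_mul, Finset.sum_const_zero, ENNReal.ofReal_zero] at hlim
  filter_upwards [hlim.eventually_lt_const hε] with c' hc'
  refine (edist_le_of_forall fun x => ?_).trans_lt hc'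
  rw [edist_dist, Real.dist_eq]
  refine ENNReal.ofReal_le_ofReal ?_
  simp only [linearComb]
  rw [← Finset.sum_sub_distrib]
  refine (Finset.abs_sum_le_sum_abs _ _).trans (Finset.sum_le_sum fun i _ => ?_)
  rw [← sub_mul, abs_mul]
  exact mul_le_mul_of_nonneg_left (hM i x) (abs_nonneg _)

theorem aemeasurable_linearComb {ι Ω : Type*} [Fintype ι] [MeasurableSpace Ω] {P : Measure Ω}
    (g : ι → RBox a b → ℝ) (hg : ∀ i, IsLamp (g i)) (hbdd : ∀ i, ∃ M, ∀ x, |g i x| ≤ M)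
    {c : ι → Ω → ℝ} (hc : ∀ i, AEMeasurable (c i) P) :
    AEMeasurable (fun ω => linearComb g hg fun i => c i ω) P :=
  (continuous_linearComb g hg hbdd).measurable.comp_aemeasurable (aemeasurable_pi_lambda _ hc)

end SkorohodSpace

/-! ### Ladders and Riemann–Stieltjes sums against product functions. -/

theorem altSum_prod {ι : Type*} [Fintype ι] [DecidableEq ι] (C : ℝ) (f : ι → ℝ → ℝ)
    (a b : ι → ℝ) :
    altSum (fun x => C * ∏ j, f j (x j)) a b = C * ∏ j, (f j (b j) - f j (a j)) := by
  rw [Finset.prod_sub, Finset.powerset_univ, Finset.mul_sum, altSum]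
  refine Finset.sum_congr rfl fun v _ => ?_
  have h : ∏ j, f j (v.piecewise a b j) = (∏ j ∈ v, f j (a j)) * ∏ j ∈ Finset.univ \ v, f j (b j) := by
    rw [← Finset.prod_mul_prod_compl v, Finset.compl_eq_univ_sdiff]
    congr 1
    · exact Finset.prod_congr rfl fun j hj => by rw [Finset.piecewise_eq_of_mem _ _ _ hj]
    · exact Finset.prod_congr rfl fun j hj => by
        rw [Finset.piecewise_eq_of_notMem _ _ _ (Finset.mem_sdiff.1 hj).2]
  rw [h]
  ring

namespace Ladder

variable {ι : Type*} {a b : ι → ℝ}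

theorem le_pt (Y : Ladder a b) (j : ι) (i : ℕ) : a j ≤ Y.pt j i :=
  (Y.first j).symm.le.trans (Y.mono j (Nat.zero_le i))

theorem pt_le (Y : Ladder a b) (j : ι) {i : ℕ} (hi : i ≤ Y.size j) : Y.pt j i ≤ b j :=
  (Y.mono j hi).trans (Y.last j).le

theorem lower_le_upper (Y : Ladder a b) (k : ι → ℕ) : Y.lower k ≤ Y.upper k :=
  fun j => Y.mono j (Nat.le_succ _)

theorem pairwise_disjoint_cells (Y : Ladder a b) :
    Pairwise fun k k' : ι → ℕ => Disjoint (Set.univ.pi fun j => Set.Ioc (Y.lower k j) (Y.upper k j))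
      (Set.univ.pi fun j => Set.Ioc (Y.lower k' j) (Y.upper k' j)) := by
  intro k k' hkk
  obtain ⟨j, hj⟩ := Function.ne_iff.1 hkk
  refine Set.disjoint_left.2 fun x hx hx' => ?_
  exact Set.disjoint_left.1 ((Y.mono j).pairwise_disjoint_on_Ioc_succ hj)
    (hx j trivial) (hx' j trivial)

/-- The ladder of all multiples of `(n j)⁻¹` below `b`, with lower corner zero. -/
noncomputable def grid (b : ι → ℝ) (n : ι → ℕ) (hn : ∀ j, 0 < n j)
    (hb : ∀ j, b j ∈ Set.Icc (0 : ℝ) 1) : Ladder (fun _ => 0) b where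
  size := n
  -- Clamping lets the size be `n j` whatever `b j` is, with degenerate cells beyond `b j`; `b j ≤
  -- 1` makes point number `n j` equal to `b j`.
  pt j i := min (i / n j) (b j)
  mono j i i' h := by
    dsimp only
    gcongr
  first j := by simp [(hb j).1]
  last j := by
    have : (n j : ℝ) ≠ 0 := by exact_mod_cast (hn j).ne'
    simp [div_self this, (hb j).2]

variable [Fintype ι] [DecidableEq ι]

theorem mem_cells {Y : Ladder a b} {k : ι → ℕ} : k ∈ Y.cells ↔ ∀ j, k j < Y.size j := by
  simp [cells]

theorem cell_subset (Y : Ladder a b) {k : ι → ℕ} (hk : k ∈ Y.cells) :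
    Set.Icc (Y.lower k) (Y.upper k) ⊆ Set.Icc a b :=
  Set.Icc_subset_Icc (fun j => Y.le_pt j _) fun j => Y.pt_le j (mem_cells.1 hk j)

/-- The half-open cells of a ladder partition the half-open box. -/
theorem biUnion_cells (Y : Ladder a b) :
    ⋃ k ∈ Y.cells, (Set.univ.pi fun j => Set.Ioc (Y.lower k j) (Y.upper k j)) =
      Set.univ.pi fun j => Set.Ioc (a j) (b j) := by
  have h : ∀ j, ⋃ i ∈ Finset.range (Y.size j), Set.Ioc (Y.pt j i) (Y.pt j (i + 1)) =
      Set.Ioc (a j) (b j) := by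
    intro j
    have := (Y.mono j).biUnion_Ico_Ioc_map_succ 0 (Y.size j)
    rw [Y.first, Y.last] at this
    rw [← this]
    simp
  ext x
  simp only [Set.mem_iUnion, Set.mem_pi, Set.mem_univ, true_imp_iff, exists_prop, ← h,
    Finset.mem_range, mem_cells]
  constructor
  · rintro ⟨k, hk, hx⟩ j
    exact ⟨k j, hk j, hx j⟩
  · intro hx
    choose k hk hx using hx
    exact ⟨k, hk, hx⟩

/-- The sum over cells factors into one telescoping sum per coordinate. -/
theorem sum_prod_edges (Y : Ladder a b) :
    ∑ k ∈ Y.cells, ∏ j, (Y.upper k j - Y.lower k j) = ∏ j, (b j - a j) := by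
  have := Finset.prod_univ_sum (fun j => Finset.range (Y.size j))
    fun j i => Y.pt j (i + 1) - Y.pt j i
  simp only [Finset.sum_range_sub, Y.first, Y.last] at this
  exact this.symm

end Ladder

theorem setIntegral_pi_prod {ι : Type*} [Fintype ι] (s : ι → Set ℝ) (f : ι → ℝ → ℝ) :
    ∫ x in Set.univ.pi s, ∏ j, f j (x j) = ∏ j, ∫ x in s j, f j x := by
  rw [volume_pi, Measure.restrict_pi_pi]
  exact integral_fintype_prod_eq_prod _

/-- Fubini and the fundamental theorem of calculus in each coordinate. It makes the Stieltjes
increment over a cell an integral of the mixed derivative. -/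
theorem integral_prod_deriv {ι : Type*} [Fintype ι] {a b : ι → ℝ} (hab : a ≤ b)
    {f f' : ι → ℝ → ℝ} (hf : ∀ j x, HasDerivAt (f j) (f' j x) x) (hf' : ∀ j, Continuous (f' j)) :
    ∫ x in Set.univ.pi fun j => Set.Ioc (a j) (b j), ∏ j, f' j (x j) =
      ∏ j, (f j (b j) - f j (a j)) := by
  rw [setIntegral_pi_prod]
  refine Finset.prod_congr rfl fun j _ => ?_
  rw [← intervalIntegral.integral_of_le (hab j)]
  exact intervalIntegral.integral_eq_sub_of_hasDerivAt (fun x _ => hf j x)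
    ((hf' j).intervalIntegrable _ _)

/-- The distance between a Riemann-Stieltjes sum with respect to a product of smooth functions
and an integral. -/
theorem abs_rsSum_sub_integral_le {ι : Type*} [Fintype ι] [DecidableEq ι] {a b : ι → ℝ}
    (Y : Ladder a b) {f f' : ι → ℝ → ℝ} (hf : ∀ j x, HasDerivAt (f j) (f' j x) x)
    (hf' : ∀ j, Continuous (f' j)) (C : ℝ) {D h : (ι → ℝ) → ℝ}
    (hD : ContinuousOn D (Set.Icc a b)) (hh : ContinuousOn h (Set.Icc a b)) {H : (ι → ℕ) → ℝ}
    {η M κ N : ℝ}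
    (hη : ∀ k ∈ Y.cells, ∀ x ∈ Set.Icc (Y.lower k) (Y.upper k), |H k - h x| ≤ η)
    (hM : ∀ x ∈ Set.Icc a b, |C * ∏ j, f' j (x j)| ≤ M)
    (hκ : ∀ x ∈ Set.Icc a b, |C * ∏ j, f' j (x j) - D x| ≤ κ)
    (hN : ∀ x ∈ Set.Icc a b, |h x| ≤ N) :
    |∑ k ∈ Y.cells, H k * (C * ∏ j, (f j (Y.upper k j) - f j (Y.lower k j))) -
      ∫ x in Set.Icc a b, h x * D x| ≤ (η * M + N * κ) * ∏ j, (b j - a j) := by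
  have hI : ∀ {g : (ι → ℝ) → ℝ} {k}, k ∈ Y.cells → ContinuousOn g (Set.Icc a b) →
      IntegrableOn g (Set.univ.pi fun j => Set.Ioc (Y.lower k j) (Y.upper k j)) := by
    intro g k hk hg
    refine (hg.integrableOn_compact isCompact_Icc).mono_set fun x hx => ?_
    exact Y.cell_subset hk ⟨fun j => (hx j trivial).1.le, fun j => (hx j trivial).2⟩
  have hprod : Continuous fun x : ι → ℝ => C * ∏ j, f' j (x j) := by fun_prop
  have hhD : ContinuousOn (fun x => h x * D x) (Set.Icc a b) := hh.mul hD
  have h1 : ∫ x in Set.Icc a b, h x * D x = ∑ k ∈ Y.cells,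
      ∫ x in Set.univ.pi fun j => Set.Ioc (Y.lower k j) (Y.upper k j), h x * D x := by
    rw [← integral_biUnion_finset _ (fun k _ => MeasurableSet.univ_pi fun j => measurableSet_Ioc)
      (Y.pairwise_disjoint_cells.set_pairwise _) (fun k hk => hI hk hhD), Y.biUnion_cells]
    refine (setIntegral_congr_set ?_).symm
    rw [volume_pi]
    exact Measure.univ_pi_Ioc_ae_eq_Icc
  -- Each Stieltjes term is itself an integral over its cell, so sum and integral can be compared
  -- cell by cell. The weights `H k` need not be values of `h`; later they are values of a
  -- discontinuous partial sum field.
  have h2 : ∀ k ∈ Y.cells, H k * (C * ∏ j, (f j (Y.upper k j) - f j (Y.lower k j))) =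
      ∫ x in Set.univ.pi fun j => Set.Ioc (Y.lower k j) (Y.upper k j),
        H k * (C * ∏ j, f' j (x j)) := by
    intro k _
    rw [integral_const_mul, integral_const_mul, integral_prod_deriv (Y.lower_le_upper k) hf hf']
  rw [h1, Finset.sum_congr rfl h2, ← Finset.sum_sub_distrib, ← Y.sum_prod_edges, Finset.mul_sum]
  refine (Finset.abs_sum_le_sum_abs _ _).trans (Finset.sum_le_sum fun k hk => ?_)
  have hHk : ContinuousOn (fun x => H k * (C * ∏ j, f' j (x j))) (Set.Icc a b) :=
    (continuous_const.mul hprod).continuousOn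
  rw [← integral_sub (hI hk hHk) (hI hk hhD)]
  have hvol : volume.real (Set.univ.pi fun j => Set.Ioc (Y.lower k j) (Y.upper k j)) =
      ∏ j, (Y.upper k j - Y.lower k j) := by
    rw [Measure.real, Real.volume_pi_Ioc_toReal (Y.lower_le_upper k)]
  rw [← hvol, ← Real.norm_eq_abs]
  refine norm_setIntegral_le_of_norm_le_const ?_ fun x hx => ?_
  · rw [Real.volume_pi_Ioc]
    exact ENNReal.prod_lt_top fun _ _ => ENNReal.ofReal_lt_top
  have hx' : x ∈ Set.Icc (Y.lower k) (Y.upper k) :=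
    ⟨fun j => (hx j trivial).1.le, fun j => (hx j trivial).2⟩
  have hxab := Y.cell_subset hk hx'
  calc ‖H k * (C * ∏ j, f' j (x j)) - h x * D x‖
      = |(H k - h x) * (C * ∏ j, f' j (x j)) + h x * (C * ∏ j, f' j (x j) - D x)| := by
        rw [Real.norm_eq_abs]; ring_nf
    _ ≤ |H k - h x| * |C * ∏ j, f' j (x j)| + |h x| * |C * ∏ j, f' j (x j) - D x| := by
        rw [← abs_mul, ← abs_mul]; exact abs_add_le _ _
    _ ≤ η * M + N * κ := by
        gcongr
        · exact (abs_nonneg _).trans (hη k hk x hx')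
        · exact hη k hk x hx'
        · exact hM x hxab
        · exact (abs_nonneg _).trans (hN x hxab)
        · exact hN x hxab
        · exact hκ x hxab

/-- A continuous function is Riemann-Stieltjes integrable with respect to a product of smooth
functions. -/
theorem hasRSIntegral_prod {ι : Type*} [Fintype ι] [DecidableEq ι] {a b : ι → ℝ}
    {f f' : ι → ℝ → ℝ} (hf : ∀ j x, HasDerivAt (f j) (f' j x) x)
    (hf' : ∀ j, Continuous (f' j)) (C : ℝ) {h : (ι → ℝ) → ℝ}
    (hh : ContinuousOn h (Set.Icc a b)) :
    HasRSIntegral h (fun x => C * ∏ j, f j (x j)) a b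
      (∫ x in Set.Icc a b, h x * (C * ∏ j, f' j (x j))) := by
  intro ε hε
  have hprod : Continuous fun x : ι → ℝ => C * ∏ j, f' j (x j) := by fun_prop
  obtain ⟨M, hM⟩ := isCompact_Icc.exists_bound_of_continuousOn (s := Set.Icc a b)
    hprod.continuousOn
  obtain ⟨N, hN⟩ := isCompact_Icc.exists_bound_of_continuousOn hh
  -- The `+ 1` prevents division by zero and makes the final inequality strict.
  have hB : 0 < |M| * |∏ j, (b j - a j)| + 1 := by positivity
  obtain ⟨δ, hδ, hδ'⟩ := Metric.uniformContinuousOn_iff.1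
    (isCompact_Icc.uniformContinuousOn_of_continuous hh)
    (ε / (|M| * |∏ j, (b j - a j)| + 1)) (by positivity)
  refine ⟨δ, hδ, fun Y hY tag htag => ?_⟩
  simp only [altSum_prod]
  have := abs_rsSum_sub_integral_le Y hf hf' C hprod.continuousOn hh (H := fun k => h (tag k))
    (η := ε / (|M| * |∏ j, (b j - a j)| + 1)) (κ := 0)
    (fun k hk x hx => (hδ' _ (Y.cell_subset hk (htag k hk)) _ (Y.cell_subset hk hx)
      ((dist_pi_lt_iff hδ).2 fun j => ?_)).le) hM (fun x _ => by simp) hN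
  · refine this.trans_lt ?_
    rw [mul_zero, add_zero]
    calc ε / (|M| * |∏ j, (b j - a j)| + 1) * M * ∏ j, (b j - a j)
        = ε * ((M * ∏ j, (b j - a j)) / (|M| * |∏ j, (b j - a j)| + 1)) := by ring
      _ < ε * 1 := by
        refine mul_lt_mul_of_pos_left ?_ hε
        rw [div_lt_one hB, ← abs_mul]
        exact (le_abs_self _).trans_lt (lt_add_one _)
      _ = ε := mul_one ε
  · have h1 := hY j (k j) (Ladder.mem_cells.1 hk j)
    have h2 := (htag k hk).1 j
    have h3 := (htag k hk).2 j
    have h4 := hx.1 j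
    have h5 := hx.2 j
    simp only [Ladder.lower, Ladder.upper] at h2 h3 h4 h5
    rw [Real.dist_eq, abs_lt]
    constructor <;> linarith

/-! ### The reconstruction kernel -/

/-- At `0`, `sinc` is the divided slope of `sin`, whose power series is that of `sin` shifted by
one; elsewhere it is a quotient of analytic functions. -/
theorem Real.analyticAt_sinc (x : ℝ) : AnalyticAt ℝ Real.sinc x := by
  by_cases hx : x = 0
  · subst hx
    obtain ⟨p, hp⟩ := Real.analyticAt_sin (x := 0)
    rw [Real.sinc_eq_dslope]
    exact ⟨_, hp.has_fpower_series_dslope_fslope⟩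
  · have h : AnalyticAt ℝ (fun y => Real.sin y / y) x :=
      Real.analyticAt_sin.div analyticAt_id hx
    refine h.congr ?_
    filter_upwards [isOpen_ne.mem_nhds hx] with y hy
    exact (Real.sinc_of_ne_zero hy).symm

theorem Real.contDiff_sinc : ContDiff ℝ 1 Real.sinc :=
  contDiff_iff_contDiffAt.2 fun x => (Real.analyticAt_sinc x).contDiffAt

theorem Real.continuous_deriv_sinc : Continuous (deriv Real.sinc) :=
  Real.contDiff_sinc.continuous_deriv le_rfl

/-- One factor of the integrand, `x ↦ sin (w (r - T x)) / (π (r - T x))`. -/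
noncomputable def kernelFactor (w T r x : ℝ) : ℝ := w / Real.pi * Real.sinc (w * (r - T * x))

/-- The derivative of `kernelFactor w T r`. -/
noncomputable def kernelFactorDeriv (w T r x : ℝ) : ℝ :=
  w / Real.pi * (deriv Real.sinc (w * (r - T * x)) * (w * -T))

theorem hasDerivAt_kernelFactor (w T r x : ℝ) :
    HasDerivAt (kernelFactor w T r) (kernelFactorDeriv w T r x) x := by
  have h1 : HasDerivAt (fun x => w * (r - T * x)) (w * -T) x := by
    have := (((hasDerivAt_id x).const_mul T).const_sub r).const_mul w
    simpa using this
  have h2 : HasDerivAt Real.sinc (deriv Real.sinc (w * (r - T * x))) (w * (r - T * x)) :=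
    (Real.contDiff_sinc.differentiable one_ne_zero _).hasDerivAt
  exact (h2.comp x h1).const_mul _

theorem continuous_kernelFactorDeriv (w T r : ℝ) : Continuous (kernelFactorDeriv w T r) := by
  have := Real.continuous_deriv_sinc
  unfold kernelFactorDeriv
  fun_prop

theorem limitIntegrand_eq_prod (W T : Fin 3 → ℝ) (u : Fin 4 → ℝ) (z : Fin 3 → ℝ) :
    limitIntegrand W T u z = ∏ j, kernelFactor (W j) (T j) (u j.succ) (z j) := rfl

/-- The mixed partial derivative of the integrand in the variables in `v`. -/
noncomputable def mixedKernel (W : Fin 3 → ℝ) (v : Finset (Fin 3)) (T : Fin 3 → ℝ)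
    (u : Fin 4 → ℝ) (x : Fin 3 → ℝ) : ℝ :=
  ∏ j, if j ∈ v then kernelFactorDeriv (W j) (T j) (u j.succ) (x j)
    else kernelFactor (W j) (T j) (u j.succ) (x j)

/-- Continuity is joint, with the scale `T` as a variable too, because `n j * τ j (n j)` will be
replaced by its limit uniformly in the other arguments. -/
theorem continuous_mixedKernel (W : Fin 3 → ℝ) (v : Finset (Fin 3)) :
    Continuous fun y : (Fin 3 → ℝ) × (Fin 4 → ℝ) × (Fin 3 → ℝ) =>
      mixedKernel W v y.1 y.2.1 y.2.2 := by
  have := Real.continuous_deriv_sinc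
  refine continuous_finsetProd _ fun j _ => ?_
  split_ifs
  · unfold kernelFactorDeriv
    fun_prop
  · unfold kernelFactor
    fun_prop

/-! ### Faces of boxes -/

section Glue

variable {q : ℕ} {a b : Fin q → ℝ}

theorem prod_glue (F : Fin q → ℝ → ℝ) (a b : Fin q → ℝ) (v w : Finset (Fin q)) (x : v → ℝ) :
    ∏ j, F j (glue a b v w x j) =
      (∏ j ∈ vᶜ, F j (if j ∈ w then a j else b j)) * ∏ j : v, F j (x j) := by
  rw [← Finset.prod_mul_prod_compl v, mul_comm]
  congr 1
  · refine Finset.prod_congr rfl fun j hj => ?_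
    rw [glue, dif_neg (Finset.mem_compl.1 hj)]
  · rw [← Finset.prod_coe_sort]
    refine Finset.prod_congr rfl fun j _ => ?_
    rw [glue, dif_pos j.2]

theorem glue_mem_Icc (hab : a ≤ b) (v w : Finset (Fin q)) {x : v → ℝ}
    (hx : x ∈ Set.Icc (fun j : v => a j) (fun j : v => b j)) :
    glue a b v w x ∈ Set.Icc a b := by
  rw [← Set.pi_univ_Icc]
  intro j _
  simp only [glue]
  split_ifs with h h'
  · exact ⟨hx.1 ⟨j, h⟩, hx.2 ⟨j, h⟩⟩
  · exact ⟨le_rfl, hab j⟩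
  · exact ⟨hab j, le_rfl⟩

theorem continuous_glue (a b : Fin q → ℝ) (v w : Finset (Fin q)) : Continuous (glue a b v w) := by
  refine continuous_pi fun j => ?_
  simp only [glue]
  split_ifs <;> fun_prop

end Glue

/-- On a face the factors outside `v` are frozen, which leaves the form `C * ∏ f'` required by
`hasRSIntegral_prod`. -/
theorem mixedKernel_glue (W : Fin 3 → ℝ) (v w : Finset (Fin 3)) (T : Fin 3 → ℝ)
    (u : Fin 4 → ℝ) (a b : Fin 3 → ℝ) (x : v → ℝ) :
    mixedKernel W v T u (glue a b v w x) =
      (∏ j ∈ vᶜ, kernelFactor (W j) (T j) (u j.succ) (if j ∈ w then a j else b j)) *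
        ∏ j : v, kernelFactorDeriv (W j) (T j) (u (j : Fin 3).succ) (x j) := by
  rw [mixedKernel, prod_glue (fun j y => if j ∈ v then kernelFactorDeriv (W j) (T j) (u j.succ) y
    else kernelFactor (W j) (T j) (u j.succ) y)]
  congr 1
  · refine Finset.prod_congr rfl fun j hj => ?_
    rw [if_neg (Finset.mem_compl.1 hj)]
  · refine Finset.prod_congr rfl fun j _ => ?_
    rw [if_pos j.2]

/-! ### The integral by parts -/

section Grid

variable {ι : Type*} {b : ι → ℝ} {n : ι → ℕ}

theorem Ladder.grid_upper_sub_lower_le (hn : ∀ j, 0 < n j) (hb : ∀ j, b j ∈ Set.Icc (0 : ℝ) 1)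
    (j : ι) (i : ℕ) :
    (Ladder.grid b n hn hb).pt j (i + 1) - (Ladder.grid b n hn hb).pt j i ≤ (n j : ℝ)⁻¹ := by
  have h : ((i + 1 : ℕ) : ℝ) / n j = i / n j + (n j : ℝ)⁻¹ := by push_cast; ring
  have h' : (0 : ℝ) ≤ (n j : ℝ)⁻¹ := by positivity
  simp only [grid, h]
  rcases le_total ((i : ℝ) / n j) (b j) with h1 | h1
  · rw [min_eq_left h1]
    linarith [min_le_left ((i : ℝ) / n j + (n j : ℝ)⁻¹) (b j)]
  · rw [min_eq_right h1]
    linarith [min_le_right ((i : ℝ) / n j + (n j : ℝ)⁻¹) (b j)]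

/-- Uniqueness needs ladders of arbitrarily small mesh; the clamped grids provide them. -/
theorem HasRSIntegral.unique [Fintype ι] [DecidableEq ι] {h f : (ι → ℝ) → ℝ}
    (hb : ∀ j, b j ∈ Set.Icc (0 : ℝ) 1) {I J : ℝ} (hI : HasRSIntegral h f (fun _ => 0) b I)
    (hJ : HasRSIntegral h f (fun _ => 0) b J) : I = J := by
  by_contra hne
  have hpos : 0 < |I - J| / 2 := half_pos (abs_pos.2 (sub_ne_zero.2 hne))
  obtain ⟨δ, hδ, h1⟩ := hI _ hpos
  obtain ⟨δ', hδ', h2⟩ := hJ _ hpos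
  obtain ⟨m, hm⟩ := exists_nat_one_div_lt (lt_min hδ hδ')
  have hmesh : (Ladder.grid b (fun _ => m + 1) (fun _ => Nat.succ_pos m) hb).MeshLT (min δ δ') := by
    intro j i _
    refine (Ladder.grid_upper_sub_lower_le _ hb j i).trans_lt ?_
    simpa using hm
  have h3 := h1 _ (fun j i hi => (hmesh j i hi).trans_le (min_le_left _ _)) (Ladder.lower _)
    fun k _ => ⟨le_rfl, Ladder.lower_le_upper _ k⟩
  have h4 := h2 _ (fun j i hi => (hmesh j i hi).trans_le (min_le_right _ _)) (Ladder.lower _)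
    fun k _ => ⟨le_rfl, Ladder.lower_le_upper _ k⟩
  have h5 : |I - J| < |I - J| / 2 + |I - J| / 2 := by
    refine (abs_sub_le I _ J).trans_lt (add_lt_add ?_ h4)
    rwa [abs_sub_comm]
  linarith

theorem HasRSIntegral.rsIntegral_eq [Fintype ι] [DecidableEq ι] {h f : (ι → ℝ) → ℝ}
    {I : ℝ} (hI : HasRSIntegral h f (fun _ => 0) b I) (hb : ∀ j, b j ∈ Set.Icc (0 : ℝ) 1) :
    rsIntegral h f (fun _ => 0) b = I := by
  have H : ∃ I, HasRSIntegral h f (fun _ => 0) b I := ⟨I, hI⟩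
  rw [rsIntegral, dif_pos H]
  exact H.choose_spec.unique hb hI

end Grid

section ByParts

variable (W T : Fin 3 → ℝ) (u : Fin 4 → ℝ) {h : (Fin 3 → ℝ) → ℝ} {c : Fin 3 → ℝ}

theorem hasRSIntegral_face (hc : 0 ≤ c) (hh : ContinuousOn h (Set.Icc 0 c))
    (v w : Finset (Fin 3)) :
    HasRSIntegral (fun x => h (glue 0 c v w x)) (fun x => limitIntegrand W T u (glue 0 c v w x))
      (fun _ : v => 0) (fun j : v => c j)
      (∫ x in Set.Icc (fun _ : v => (0 : ℝ)) (fun j : v => c j),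
        h (glue 0 c v w x) * mixedKernel W v T u (glue 0 c v w x)) := by
  simp only [limitIntegrand_eq_prod, mixedKernel_glue]
  simp only [prod_glue (fun j y => kernelFactor (W j) (T j) (u j.succ) y)]
  refine hasRSIntegral_prod (fun j x => hasDerivAt_kernelFactor _ _ _ x)
    (fun j => continuous_kernelFactorDeriv _ _ _) _ ?_
  exact hh.comp (continuous_glue _ _ _ _).continuousOn fun x hx => glue_mem_Icc hc v w hx

theorem byPartsIntegrable_limitIntegrand (hc : 0 ≤ c) (hh : ContinuousOn h (Set.Icc 0 c)) :
    ByPartsIntegrable (limitIntegrand W T u) h 0 c :=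
  fun v w _ => ⟨_, hasRSIntegral_face W T u hc hh v w⟩

/-- The integral by parts of a continuous function that vanishes on the lower faces, in terms of
Lebesgue integrals. -/
theorem byPartsIntegral_limitIntegrand (hc : ∀ j, c j ∈ Set.Icc (0 : ℝ) 1)
    (hh : ContinuousOn h (Set.Icc 0 c)) (h0 : ∀ x ∈ Set.Icc 0 c, (∃ j, x j = 0) → h x = 0) :
    byPartsIntegral (limitIntegrand W T u) h 0 c = ∑ v : Finset (Fin 3), (-1) ^ v.card *
      ∫ x in Set.Icc (fun _ : v => (0 : ℝ)) (fun j : v => c j),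
        h (glue 0 c v ∅ x) * mixedKernel W v T u (glue 0 c v ∅ x) := by
  have hc0 : 0 ≤ c := fun j => (hc j).1
  refine Finset.sum_congr rfl fun v _ => ?_
  congr 1
  -- A nonempty `w` puts some coordinate at `0`, where `h` vanishes.
  rw [Finset.sum_eq_single ∅]
  · rw [Finset.card_empty, pow_zero, one_mul]
    exact (hasRSIntegral_face W T u hc0 hh v ∅).rsIntegral_eq fun j : v => hc j
  · intro w hw hne
    obtain ⟨j, hj⟩ := Finset.nonempty_iff_ne_empty.2 hne
    have hjv : j ∉ v := Finset.mem_compl.1 (Finset.mem_powerset.1 hw hj)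
    have : faceIntegral h (limitIntegrand W T u) 0 c v w = 0 := by
      refine ((hasRSIntegral_face W T u hc0 hh v w).rsIntegral_eq fun j : v => hc j).trans ?_
      refine setIntegral_eq_zero_of_forall_eq_zero fun x hx => ?_
      rw [h0 _ (glue_mem_Icc hc0 v w hx) ⟨j, by simp [glue, hjv, hj]⟩, zero_mul]
    rw [this, mul_zero]
  · simp

end ByParts

/-! ### Summation by parts -/

/-- The partial sum field of an array of numbers. -/
noncomputable def arraySum (e : (Fin 3 → ℕ) → ℝ) (n : Fin 3 → ℕ) (v : Fin 3 → ℝ) : ℝ :=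
  (√(∏ j, (n j : ℝ)))⁻¹ * ∑ i ∈ Finset.Icc (1 : Fin 3 → ℕ) (fun j => ⌊(n j : ℝ) * v j⌋₊), e i

/-- The detector statistic of an array of numbers. -/
noncomputable def arrayDetector (W : Fin 3 → ℝ) (τ : Fin 3 → ℕ → ℝ) (e : (Fin 3 → ℕ) → ℝ)
    (n : Fin 3 → ℕ) (u : Fin 4 → ℝ) : ℝ :=
  √(∏ j, τ j (n j)) * ∑ l ∈ Finset.Icc (1 : Fin 3 → ℕ) n,
    e l * if (l 0 : ℝ) / n 0 ≤ u 0 then reconKernel W (fun j => u j.succ - samplePoint τ n l j)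
      else 0

/-- One-dimensional Abel summation for a unit mass at `l / n`. With the indicator read at the lower
end of each cell, exactly the cells `k ≥ l` count, and their increments telescope to `F c - F (l /
n)`. -/
theorem sum_indicator_mul_sub {n l : ℕ} (hl : 1 ≤ l) (hln : l ≤ n) {c : ℝ} (hc : c ≤ 1)
    (F : ℝ → ℝ) :
    (if (l : ℝ) ≤ n * c then (1 : ℝ) else 0) * F c -
      ∑ k ∈ Finset.range n, (if (l : ℝ) ≤ n * min (k / n : ℝ) c then (1 : ℝ) else 0) *
        (F (min ((k + 1 : ℕ) / n : ℝ) c) - F (min (k / n : ℝ) c)) =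
      (if (l : ℝ) ≤ n * c then (1 : ℝ) else 0) * F (l / n) := by
  have hn : (0 : ℝ) < n := by exact_mod_cast hl.trans hln
  by_cases h : (l : ℝ) ≤ n * c
  · have h1 : ∀ k : ℕ, (l : ℝ) ≤ n * min (k / n : ℝ) c ↔ l ≤ k := by
      intro k
      rw [mul_min_of_nonneg _ _ hn.le, le_min_iff, mul_div_cancel₀ _ hn.ne', Nat.cast_le]
      exact and_iff_left h
    simp only [h1, h, if_true, one_mul, ite_mul, zero_mul]
    have hpl : min (l / n : ℝ) c = l / n := min_eq_left ((div_le_iff₀' hn).2 h)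
    have hpn : min (n / n : ℝ) c = c := by rw [div_self hn.ne', min_eq_right hc]
    rw [← Finset.sum_filter]
    have hf : (Finset.range n).filter (fun k => l ≤ k) = Finset.Ico l n := by
      ext k; simp [and_comm]
    rw [hf, Finset.sum_Ico_sub (fun k : ℕ => F (min (k / n : ℝ) c)) hln, hpl, hpn]
    ring
  · have h1 : ∀ k : ℕ, ¬ (l : ℝ) ≤ n * min (k / n : ℝ) c := fun k hk =>
      h (hk.trans (mul_le_mul_of_nonneg_left (min_le_right _ _) hn.le))
    simp [h1, h]

theorem arraySum_eq (e : (Fin 3 → ℕ) → ℝ) {n : Fin 3 → ℕ} {p : Fin 3 → ℝ}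
    (hp : p ∈ Set.Icc (0 : Fin 3 → ℝ) 1) :
    arraySum e n p = (√(∏ j, (n j : ℝ)))⁻¹ * ∑ l ∈ Finset.Icc (1 : Fin 3 → ℕ) n,
      e l * ∏ j, if (l j : ℝ) ≤ n j * p j then (1 : ℝ) else 0 := by
  have h0 : ∀ j, 0 ≤ (n j : ℝ) * p j := fun j => mul_nonneg (Nat.cast_nonneg _) (hp.1 j)
  have hle : ∀ j, ⌊(n j : ℝ) * p j⌋₊ ≤ n j := fun j => by
    refine (Nat.floor_mono (mul_le_mul_of_nonneg_left (hp.2 j) (Nat.cast_nonneg _))).trans ?_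
    simp
  rw [arraySum]
  congr 1
  have hprod : ∀ l : Fin 3 → ℕ, (∏ j, if (l j : ℝ) ≤ n j * p j then (1 : ℝ) else 0) =
      if ∀ j, l j ≤ ⌊(n j : ℝ) * p j⌋₊ then 1 else 0 := by
    intro l
    rw [Finset.prod_ite_zero, Finset.prod_const_one]
    simp only [Finset.mem_univ, true_imp_iff, Nat.le_floor_iff (h0 _)]
  simp only [hprod, mul_ite, mul_one, mul_zero]
  rw [← Finset.sum_filter]
  refine Finset.sum_congr ?_ fun _ _ => rfl
  ext l
  simp only [Finset.mem_Icc, Finset.mem_filter]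
  exact ⟨fun h => ⟨⟨h.1, fun j => (h.2 j).trans (hle j)⟩, h.2⟩, fun h => ⟨h.1.1, h.2⟩⟩

/-- Multivariate summation by parts. -/
theorem sum_mul_prod_eq_sum_arraySum (e : (Fin 3 → ℕ) → ℝ) {n : Fin 3 → ℕ} (hn : ∀ j, 0 < n j)
    {c : Fin 3 → ℝ} (hc : ∀ j, c j ∈ Set.Icc (0 : ℝ) 1) (F : Fin 3 → ℝ → ℝ) :
    (√(∏ j, (n j : ℝ)))⁻¹ * ∑ l ∈ Finset.Icc (1 : Fin 3 → ℕ) n,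
        e l * ∏ j, ((if (l j : ℝ) ≤ n j * c j then (1 : ℝ) else 0) * F j (l j / n j)) =
      ∑ v : Finset (Fin 3), (-1) ^ v.card *
        ∑ k ∈ (Ladder.grid (fun j : v => c j) (fun j => n j) (fun j => hn j)
            (fun j => hc j)).cells,
          arraySum e n (glue 0 c v ∅ ((Ladder.grid (fun j : v => c j) (fun j => n j)
            (fun j => hn j) (fun j => hc j)).lower k)) *
          ((∏ j ∈ vᶜ, F j (if j ∈ (∅ : Finset (Fin 3)) then (0 : Fin 3 → ℝ) j else c j)) *
            ∏ j : v, (F j ((Ladder.grid (fun j : v => c j) (fun j => n j)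
              (fun j => hn j) (fun j => hc j)).upper k j) -
              F j ((Ladder.grid (fun j : v => c j) (fun j => n j)
                (fun j => hn j) (fun j => hc j)).lower k j))) := by
  set Y : ∀ v : Finset (Fin 3), Ladder (fun _ : v => (0 : ℝ)) (fun j : v => c j) := fun v =>
    Ladder.grid (fun j : v => c j) (fun j => n j) (fun j => hn j) (fun j => hc j) with hY
  have hc0 : (0 : Fin 3 → ℝ) ≤ c := fun j => (hc j).1
  have hmem : ∀ v, ∀ k ∈ (Y v).cells, glue 0 c v ∅ ((Y v).lower k) ∈ Set.Icc (0 : Fin 3 → ℝ) 1 := by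
    intro v k hk
    have := glue_mem_Icc hc0 v ∅ (x := (Y v).lower k)
      ((Y v).cell_subset hk ⟨le_rfl, (Y v).lower_le_upper k⟩)
    exact ⟨this.1, this.2.trans fun j => (hc j).2⟩
  let A : (Fin 3 → ℕ) → Fin 3 → ℝ → ℝ := fun l j x => if (l j : ℝ) ≤ n j * x then (1 : ℝ) else 0
  have hterm : ∀ l ∈ Finset.Icc (1 : Fin 3 → ℕ) n,
      ∏ j, ((if (l j : ℝ) ≤ n j * c j then (1 : ℝ) else 0) * F j (l j / n j)) =
      ∑ v : Finset (Fin 3), (-1) ^ v.card * ∑ k ∈ (Y v).cells,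
        (∏ j, A l j (glue 0 c v ∅ ((Y v).lower k) j)) *
          ((∏ j ∈ vᶜ, F j (if j ∈ (∅ : Finset (Fin 3)) then (0 : Fin 3 → ℝ) j else c j)) *
            ∏ j : v, (F j ((Y v).upper k j) - F j ((Y v).lower k j))) := by
    intro l hl
    rw [Finset.mem_Icc] at hl
    -- Each factor becomes a boundary term minus a sum. Expanding the product, `v` records the
    -- coordinates in which the sum is taken.
    rw [Finset.prod_congr rfl fun j _ =>
      (sum_indicator_mul_sub (hl.1 j) (hl.2 j) (hc j).2 (F j)).symm,
      Finset.prod_sub, Finset.powerset_univ]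
    refine Finset.sum_congr rfl fun v _ => ?_
    rw [mul_assoc]
    congr 1
    rw [← Finset.prod_coe_sort v, Finset.prod_univ_sum, Finset.mul_sum]
    refine Finset.sum_congr rfl fun k _ => ?_
    rw [prod_glue, ← Finset.compl_eq_univ_sdiff, Finset.prod_mul_distrib, Finset.prod_mul_distrib]
    simp only [Finset.notMem_empty, if_false]
    rw [mul_mul_mul_comm]
    rfl
  rw [Finset.sum_congr rfl fun l hl => by rw [hterm l hl]]
  simp only [Finset.mul_sum]
  rw [Finset.sum_comm]
  refine Finset.sum_congr rfl fun v _ => ?_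
  rw [Finset.sum_comm]
  refine Finset.sum_congr rfl fun k hk => ?_
  rw [arraySum_eq e (hmem v k hk), Finset.mul_sum, Finset.sum_mul, Finset.mul_sum]
  refine Finset.sum_congr rfl fun l _ => ?_
  simp only [A]
  ring

theorem upperCorner_mem {u : Fin 4 → ℝ} (hu : u 0 ∈ Set.Icc (0 : ℝ) 1) (j : Fin 3) :
    upperCorner u j ∈ Set.Icc (0 : ℝ) 1 := by
  rw [upperCorner, Function.update_apply]
  split_ifs
  · exact hu
  · simp

/-- Rescaling to the unit cube: `l j * τ j (n j)` is `n j * τ j (n j)` times the grid point `l j / n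
j`, and the normalization splits accordingly. -/
theorem arrayDetector_eq (W : Fin 3 → ℝ) (τ : Fin 3 → ℕ → ℝ) (e : (Fin 3 → ℕ) → ℝ)
    {n : Fin 3 → ℕ} (hn : ∀ j, 0 < n j) (u : Fin 4 → ℝ) :
    arrayDetector W τ e n u = √(∏ j, (n j * τ j (n j))) *
      ((√(∏ j, (n j : ℝ)))⁻¹ * ∑ l ∈ Finset.Icc (1 : Fin 3 → ℕ) n,
        e l * ∏ j, ((if (l j : ℝ) ≤ n j * upperCorner u j then (1 : ℝ) else 0) *
          kernelFactor (W j) (n j * τ j (n j)) (u j.succ) (l j / n j))) := by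
  have hn' : ∀ j, (0 : ℝ) < n j := fun j => by exact_mod_cast hn j
  have hpos : 0 < √(∏ j, (n j : ℝ)) := Real.sqrt_pos.2 (Finset.prod_pos fun j _ => hn' j)
  rw [Finset.prod_mul_distrib, Real.sqrt_mul (Finset.prod_nonneg fun j _ => (hn' j).le), arrayDetector,
    mul_comm (√(∏ j, (n j : ℝ))), mul_assoc, mul_inv_cancel_left₀ hpos.ne']
  congr 1
  refine Finset.sum_congr rfl fun l hl => ?_
  rw [Finset.mem_Icc] at hl
  congr 1
  have hk : ∏ j, kernelFactor (W j) (n j * τ j (n j)) (u j.succ) (l j / n j) =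
      reconKernel W (fun j => u j.succ - samplePoint τ n l j) := by
    refine Finset.prod_congr rfl fun j _ => ?_
    have : (n j : ℝ) * τ j (n j) * (l j / n j) = l j * τ j (n j) := by
      have := (hn' j).ne'
      field_simp
    rw [kernelFactor, this]
    rfl
  rw [Finset.prod_mul_distrib, hk, Finset.prod_ite_zero, Finset.prod_const_one]
  -- Only direction `0` restricts; in the others the corner is `1` and `l ≤ n`.
  have hiff : (∀ i ∈ Finset.univ, (l i : ℝ) ≤ n i * upperCorner u i) ↔ (l 0 : ℝ) / n 0 ≤ u 0 := by
    rw [div_le_iff₀' (hn' 0)]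
    constructor
    · intro h
      simpa [upperCorner] using h 0 (Finset.mem_univ _)
    · intro h i _
      by_cases hi : i = 0
      · subst hi
        simpa [upperCorner] using h
      · rw [upperCorner, Function.update_of_ne hi, Pi.one_apply, mul_one]
        exact_mod_cast hl.2 i
  simp only [hiff, ite_mul, one_mul, zero_mul]

/-! ### Convergence of the detector statistic of an array -/

/-- The integral of the kernel with respect to `z` over the box with upper corner `(s, 1, 1)`, after
integration by parts, if `z` vanishes on the lower faces. -/
noncomputable def limitSum (W T : Fin 3 → ℝ) (z : (Fin 3 → ℝ) → ℝ) (u : Fin 4 → ℝ) : ℝ :=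
  ∑ v : Finset (Fin 3), (-1) ^ v.card *
    ∫ x in Set.Icc (fun _ : v => (0 : ℝ)) (fun j : v => upperCorner u j),
      z (glue 0 (upperCorner u) v ∅ x) * mixedKernel W v T u (glue 0 (upperCorner u) v ∅ x)

theorem exists_abs_mixedKernel_le (W : Fin 3 → ℝ) {L : Set (Fin 3 → ℝ)} (hL : IsCompact L)
    {K : Set (Fin 4 → ℝ)} (hK : IsCompact K) :
    ∃ M > 0, ∀ v, ∀ T ∈ L, ∀ u ∈ K, ∀ x ∈ Set.Icc (0 : Fin 3 → ℝ) 1,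
      |mixedKernel W v T u x| ≤ M := by
  have h := fun v => (hL.prod (hK.prod (isCompact_Icc (a := (0 : Fin 3 → ℝ))
    (b := 1)))).exists_bound_of_continuousOn (continuous_mixedKernel W v).continuousOn
  choose M hM using h
  refine ⟨∑ v, |M v| + 1, by positivity, fun v T hT u hu x hx => ?_⟩
  refine (hM v (T, u, x) ⟨hT, hu, hx⟩).trans ((le_abs_self _).trans ?_)
  linarith [Finset.single_le_sum (f := fun v => |M v|) (fun _ _ => abs_nonneg _)
    (Finset.mem_univ v)]

theorem eventually_abs_mixedKernel_sub_le (W : Fin 3 → ℝ) {K : Set (Fin 4 → ℝ)} (hK : IsCompact K)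
    (T₀ : Fin 3 → ℝ) {κ : ℝ} (hκ : 0 < κ) :
    ∀ᶠ T in 𝓝 T₀, ∀ v, ∀ u ∈ K, ∀ x ∈ Set.Icc (0 : Fin 3 → ℝ) 1,
      |mixedKernel W v T u x - mixedKernel W v T₀ u x| ≤ κ := by
  rw [eventually_all]
  intro v
  have hcomp : IsCompact (Metric.closedBall T₀ 1 ×ˢ (K ×ˢ Set.Icc (0 : Fin 3 → ℝ) 1)) :=
    (isCompact_closedBall _ _).prod (hK.prod isCompact_Icc)
  obtain ⟨δ, hδ, h⟩ := Metric.uniformContinuousOn_iff.1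
    (hcomp.uniformContinuousOn_of_continuous (continuous_mixedKernel W v).continuousOn) κ hκ
  filter_upwards [Metric.ball_mem_nhds T₀ hδ, Metric.closedBall_mem_nhds T₀ one_pos]
    with T hT hT1 u hu x hx
  have := h (T, u, x) ⟨hT1, hu, hx⟩ (T₀, u, x) ⟨Metric.mem_closedBall_self zero_le_one, hu, hx⟩
    (by simpa [Prod.dist_eq, hδ] using hT)
  exact this.le

theorem prod_upperCorner_le_one {u : Fin 4 → ℝ} (hu : u 0 ∈ Set.Icc (0 : ℝ) 1)
    (v : Finset (Fin 3)) : ∏ j : v, (upperCorner u j - 0) ≤ 1 := by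
  refine Finset.prod_le_one (fun j _ => ?_) fun j _ => ?_
  · simpa using (upperCorner_mem hu j).1
  · simpa using (upperCorner_mem hu j).2

theorem glue_upperCorner_mem {u : Fin 4 → ℝ} (hu : u 0 ∈ Set.Icc (0 : ℝ) 1) (v w : Finset (Fin 3))
    {x : v → ℝ} (hx : x ∈ Set.Icc (fun _ : v => (0 : ℝ)) (fun j : v => upperCorner u j)) :
    glue 0 (upperCorner u) v w x ∈ Set.Icc (0 : Fin 3 → ℝ) 1 := by
  have := glue_mem_Icc (a := 0) (b := upperCorner u) (fun j => (upperCorner_mem hu j).1) v w hx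
  exact ⟨this.1, this.2.trans fun j => (upperCorner_mem hu j).2⟩

theorem exists_abs_limitSum_le (W T : Fin 3 → ℝ) {z : (Fin 3 → ℝ) → ℝ}
    (hz : ContinuousOn z (Set.Icc 0 1)) {K : Set (Fin 4 → ℝ)} (hK : IsCompact K)
    (hK0 : ∀ u ∈ K, u 0 ∈ Set.Icc (0 : ℝ) 1) : ∃ C, ∀ u ∈ K, |limitSum W T z u| ≤ C := by
  obtain ⟨M, hM0, hM⟩ := exists_abs_mixedKernel_le W (isCompact_singleton (x := T)) hK
  obtain ⟨N, hN⟩ := isCompact_Icc.exists_bound_of_continuousOn hz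
  refine ⟨∑ _v : Finset (Fin 3), N * M, fun u hu => ?_⟩
  refine (Finset.abs_sum_le_sum_abs _ _).trans (Finset.sum_le_sum fun v _ => ?_)
  rw [abs_mul, abs_pow, abs_neg, abs_one, one_pow, one_mul, ← Real.norm_eq_abs]
  have hN0 : 0 ≤ N := (norm_nonneg _).trans (hN 0 ⟨le_rfl, zero_le_one⟩)
  have hvol : volume.real (Set.Icc (fun _ : v => (0 : ℝ)) (fun j : v => upperCorner u j)) ≤ 1 := by
    rw [Measure.real, Real.volume_Icc_pi_toReal fun j : v => (upperCorner_mem (hK0 u hu) j).1]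
    exact prod_upperCorner_le_one (hK0 u hu) v
  refine (norm_setIntegral_le_of_norm_le_const (C := N * M) isCompact_Icc.measure_lt_top
    fun x hx => ?_).trans ?_
  · have hx' := glue_upperCorner_mem (hK0 u hu) v ∅ hx
    rw [norm_mul]
    exact mul_le_mul (hN _ hx') (hM v T rfl u hu _ hx') (norm_nonneg _) hN0
  · exact mul_le_of_le_one_right (mul_nonneg hN0 hM0.le) hvol

theorem tendsto_eval_atTop_pi {ι : Type*} (j : ι) :
    Tendsto (fun n : ι → ℕ => n j) atTop atTop :=
  tendsto_atTop.2 fun m => (eventually_ge_atTop fun _ => m).mono fun _ h => h j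

section Core

variable (W : Fin 3 → ℝ) {τ : Fin 3 → ℕ → ℝ} {τbar : Fin 3 → ℝ}
  (hτ : ∀ j, Tendsto (fun m : ℕ => (m : ℝ) * τ j m) atTop (𝓝 (τbar j)))
  {z : (Fin 3 → ℝ) → ℝ} (hz : ContinuousOn z (Set.Icc 0 1)) {K : Set (Fin 4 → ℝ)}
  (hK : IsCompact K) (hK0 : ∀ u ∈ K, u 0 ∈ Set.Icc (0 : ℝ) 1)

include hτ in
theorem tendsto_scaled_periods :
    Tendsto (fun (n : Fin 3 → ℕ) j => (n j : ℝ) * τ j (n j)) atTop (𝓝 τbar) :=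
  tendsto_pi_nhds.2 fun j => (hτ j).comp (tendsto_eval_atTop_pi j)

-- After summation by parts each `v` contributes a Stieltjes sum weighted by partial sums at lower
-- corners. Its error comes from replacing these by `z`, from the oscillation of `z` on a cell, and
-- from replacing the scaled periods by `τbar`. All three are uniform in `u` by compactness.
include hτ hz hK hK0 in
theorem eventually_abs_sum_sub_limitSum_le {ε : ℝ} (hε : 0 < ε) :
    ∃ δ > 0, ∀ᶠ n : Fin 3 → ℕ in atTop, ∀ e : (Fin 3 → ℕ) → ℝ,
      (∀ p ∈ Set.Icc (0 : Fin 3 → ℝ) 1, |arraySum e n p - z p| < δ) → ∀ u ∈ K,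
      |(√(∏ j, (n j : ℝ)))⁻¹ * ∑ l ∈ Finset.Icc (1 : Fin 3 → ℕ) n,
        e l * ∏ j, ((if (l j : ℝ) ≤ n j * upperCorner u j then (1 : ℝ) else 0) *
          kernelFactor (W j) (n j * τ j (n j)) (u j.succ) (l j / n j)) -
        limitSum W τbar z u| ≤ ε := by
  obtain ⟨M, hM0, hM⟩ := exists_abs_mixedKernel_le W (isCompact_closedBall τbar 1) hK
  obtain ⟨N', hN'⟩ := isCompact_Icc.exists_bound_of_continuousOn hz
  set N := |N'| + 1 with hNdef
  have hNpos : 0 < N := by positivity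
  have hN : ∀ x ∈ Set.Icc (0 : Fin 3 → ℝ) 1, |z x| ≤ N := fun x hx =>
    (hN' x hx).trans ((le_abs_self _).trans (by linarith))
  -- There are `2 ^ 3 = 8` subsets `v`, each allowed `ε / 8`, shared equally by `η * M` and `N * κ`.
  set η := ε / (16 * M) with hη
  set κ := ε / (16 * N) with hκ
  have hηpos : 0 < η := by positivity
  have hκpos : 0 < κ := by positivity
  obtain ⟨ρ, hρ, hzρ⟩ := Metric.uniformContinuousOn_iff.1
    (isCompact_Icc.uniformContinuousOn_of_continuous hz) (η / 2) (half_pos hηpos)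
  -- The other half of `η` pays for the oscillation of `z` on a cell.
  refine ⟨η / 2, half_pos hηpos, ?_⟩
  have hmesh : ∀ᶠ n : Fin 3 → ℕ in atTop, ∀ j, (n j : ℝ)⁻¹ < ρ := by
    rw [eventually_all]
    exact fun j => (tendsto_inv_atTop_nhds_zero_nat.comp
      (tendsto_eval_atTop_pi j)).eventually_lt_const hρ
  have hT := tendsto_scaled_periods hτ
  filter_upwards [hmesh, eventually_ge_atTop (1 : Fin 3 → ℕ),
    hT.eventually (eventually_abs_mixedKernel_sub_le W hK τbar hκpos),
    hT.eventually (Metric.closedBall_mem_nhds τbar one_pos)] with n hnρ hn1 hnκ hnT e he u hu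
  have hn : ∀ j, 0 < n j := fun j => hn1 j
  have hc := upperCorner_mem (hK0 u hu)
  rw [sum_mul_prod_eq_sum_arraySum e hn hc
    fun j => kernelFactor (W j) (n j * τ j (n j)) (u j.succ), limitSum, ← Finset.sum_sub_distrib]
  have hcard : ε = ∑ _v : Finset (Fin 3), ε / 8 := by
    simp; ring
  rw [hcard]
  refine (Finset.abs_sum_le_sum_abs _ _).trans (Finset.sum_le_sum fun v _ => ?_)
  rw [← mul_sub, abs_mul, abs_pow, abs_neg, abs_one, one_pow, one_mul]
  set Y := Ladder.grid (fun j : v => upperCorner u j) (fun j => n j) (fun j => hn j)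
    (fun j => hc j) with hY
  have hglue := continuous_glue 0 (upperCorner u) v ∅
  have hmem := fun x hx => glue_upperCorner_mem (hK0 u hu) v ∅ (x := x) hx
  have hmk : Continuous fun x => mixedKernel W v τbar u x :=
    (continuous_mixedKernel W v).comp (continuous_const.prodMk (continuous_const.prodMk
      continuous_id))
  refine (abs_rsSum_sub_integral_le Y (f := fun j => kernelFactor (W j) (n j * τ j (n j))
    (u (j : Fin 3).succ)) (fun j x => hasDerivAt_kernelFactor _ _ _ x)
    (fun j => continuous_kernelFactorDeriv _ _ _)
    (∏ j ∈ vᶜ, kernelFactor (W j) (n j * τ j (n j)) (u j.succ)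
      (if j ∈ (∅ : Finset (Fin 3)) then (0 : Fin 3 → ℝ) j else upperCorner u j))
    (D := fun x => mixedKernel W v τbar u (glue 0 (upperCorner u) v ∅ x))
    (h := fun x => z (glue 0 (upperCorner u) v ∅ x))
    (H := fun k => arraySum e n (glue 0 (upperCorner u) v ∅ (Y.lower k)))
    (η := η) (M := M) (κ := κ) (N := N)
    (hmk.comp hglue).continuousOn (hz.comp hglue.continuousOn hmem) ?_ ?_ ?_ ?_).trans ?_
  · intro k hk x hx
    have hlow := hmem _ (Y.cell_subset hk ⟨le_rfl, Y.lower_le_upper k⟩)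
    have hxm := hmem _ (Y.cell_subset hk hx)
    have hdist : dist (glue 0 (upperCorner u) v ∅ (Y.lower k))
        (glue 0 (upperCorner u) v ∅ x) < ρ := by
      refine (dist_pi_lt_iff hρ).2 fun j => ?_
      simp only [glue]
      split_ifs with hj
      · have h1 := (Ladder.grid_upper_sub_lower_le (n := fun j : v => n j) (fun j => hn j)
          (fun j : v => hc j) ⟨j, hj⟩ (k ⟨j, hj⟩)).trans_lt (hnρ j)
        have h2 := hx.1 ⟨j, hj⟩
        have h3 := hx.2 ⟨j, hj⟩
        rw [← hY] at h1
        simp only [Ladder.upper, Ladder.lower] at h2 h3 ⊢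
        rw [Real.dist_eq, abs_lt]
        constructor <;> linarith
      · simp [hρ]
      · simp [hρ]
    have h1 := he _ hlow
    have h2 := hzρ _ hlow _ hxm hdist
    rw [Real.dist_eq] at h2
    calc _ ≤ _ := abs_sub_le _ (z (glue 0 (upperCorner u) v ∅ (Y.lower k))) _
      _ ≤ η / 2 + η / 2 := add_le_add h1.le h2.le
      _ = η := add_halves η
  · intro x hx
    rw [← mixedKernel_glue W v ∅ (fun j => n j * τ j (n j)) u 0 (upperCorner u) x]
    exact hM v _ hnT u hu _ (hmem x hx)
  · intro x hx
    rw [← mixedKernel_glue W v ∅ (fun j => n j * τ j (n j)) u 0 (upperCorner u) x]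
    exact hnκ v u hu _ (hmem x hx)
  · exact fun x hx => hN _ (hmem x hx)
  · have h1 : η * M + N * κ = ε / 8 := by
      rw [hη, hκ]
      field_simp
      norm_num
    rw [h1]
    exact mul_le_of_le_one_right (by positivity) (prod_upperCorner_le_one (hK0 u hu) v)

include hτ hz hK hK0 in
theorem eventually_abs_arrayDetector_sub_le {ε : ℝ} (hε : 0 < ε) :
    ∃ δ > 0, ∀ᶠ n : Fin 3 → ℕ in atTop, ∀ e : (Fin 3 → ℕ) → ℝ,
      (∀ p ∈ Set.Icc (0 : Fin 3 → ℝ) 1, |arraySum e n p - z p| < δ) → ∀ u ∈ K,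
      |arrayDetector W τ e n u - √(∏ j, τbar j) * limitSum W τbar z u| ≤ ε := by
  obtain ⟨C, hC⟩ := exists_abs_limitSum_le W τbar hz hK hK0
  set a := √(∏ j, τbar j) with ha
  have ha0 : 0 ≤ a := Real.sqrt_nonneg _
  obtain ⟨δ, hδ, h⟩ := eventually_abs_sum_sub_limitSum_le W hτ hz hK hK0
    (show 0 < ε / (2 * (a + 1)) by positivity)
  have hlim : Tendsto (fun n : Fin 3 → ℕ => √(∏ j, (n j * τ j (n j)))) atTop (𝓝 a) := by
    have hcont : Continuous fun T : Fin 3 → ℝ => √(∏ j, T j) := by fun_prop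
    exact (hcont.tendsto τbar).comp (tendsto_scaled_periods hτ)
  refine ⟨δ, hδ, ?_⟩
  filter_upwards [h, eventually_ge_atTop (1 : Fin 3 → ℕ),
    hlim.eventually_le_const (lt_add_one a),
    Metric.tendsto_nhds.1 hlim (ε / (2 * (|C| + 1))) (by positivity)] with n hn hn1 hna hnd e he u hu
  rw [arrayDetector_eq W τ e (fun j => hn1 j) u]
  have h1 := hn e he u hu
  have h2 := hC u hu
  rw [Real.dist_eq] at hnd
  set A := √(∏ j, (n j * τ j (n j)))
  set S := (√(∏ j, (n j : ℝ)))⁻¹ * ∑ l ∈ Finset.Icc (1 : Fin 3 → ℕ) n,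
        e l * ∏ j, ((if (l j : ℝ) ≤ n j * upperCorner u j then (1 : ℝ) else 0) *
          kernelFactor (W j) (n j * τ j (n j)) (u j.succ) (l j / n j))
  have hA0 : 0 ≤ A := Real.sqrt_nonneg _
  calc |A * S - a * limitSum W τbar z u|
      = |A * (S - limitSum W τbar z u) + (A - a) * limitSum W τbar z u| := by ring_nf
    _ ≤ A * |S - limitSum W τbar z u| + |A - a| * |limitSum W τbar z u| := by
        refine (abs_add_le _ _).trans ?_
        rw [abs_mul, abs_mul, abs_of_nonneg hA0]
    _ ≤ (a + 1) * (ε / (2 * (a + 1))) + ε / (2 * (|C| + 1)) * (|C| + 1) := by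
        gcongr
        exact h2.trans ((le_abs_self C).trans (by linarith))
    _ = ε := by
        field_simp
        ring

end Core

theorem limitSum_const_mul (W T : Fin 3 → ℝ) (σ : ℝ) (z : (Fin 3 → ℝ) → ℝ) (u : Fin 4 → ℝ) :
    limitSum W T (fun v => σ * z v) u = σ * limitSum W T z u := by
  simp only [limitSum, Finset.mul_sum, mul_assoc, integral_const_mul]
  refine Finset.sum_congr rfl fun v _ => ?_
  ring

/-! ### Arrays with prescribed partial sums -/

/-- The point of the cube with index `i` of the grid with `n j` steps in direction `j`. -/
noncomputable def gridPoint (n i : Fin 3 → ℕ) : Fin 3 → ℝ := fun j => min ((i j : ℝ) / n j) 1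

theorem gridPoint_mem (n i : Fin 3 → ℕ) : gridPoint n i ∈ Set.Icc (0 : Fin 3 → ℝ) 1 :=
  ⟨fun _ => le_min (by positivity) zero_le_one, fun _ => min_le_right _ _⟩

/-- The array whose partial sums are the values of `z` at the grid points, obtained by Möbius
inversion. -/
noncomputable def gridArray (n : Fin 3 → ℕ) (z : (Fin 3 → ℝ) → ℝ) (l : Fin 3 → ℕ) : ℝ :=
  ∑ i ∈ Finset.Icc 1 l, √(∏ j, (n j : ℝ)) * z (gridPoint n i) * IncidenceAlgebra.mu ℝ i l

/-- After interchanging the sums, the Möbius function summed over `[i, k]` leaves only `i = k`. -/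
theorem sum_gridArray (n : Fin 3 → ℕ) (z : (Fin 3 → ℝ) → ℝ) {k : Fin 3 → ℕ} (hk : 1 ≤ k) :
    ∑ l ∈ Finset.Icc 1 k, gridArray n z l = √(∏ j, (n j : ℝ)) * z (gridPoint n k) := by
  simp only [gridArray]
  rw [Finset.sum_comm' (t' := Finset.Icc 1 k) (s' := fun i => Finset.Icc i k)]
  · simp only [← Finset.mul_sum, IncidenceAlgebra.sum_Icc_mu_right]
    simp [hk]
  · intro l i
    simp only [Finset.mem_Icc]
    constructor
    · rintro ⟨⟨_, h2⟩, h3, h4⟩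
      exact ⟨⟨h4, h2⟩, h3, h4.trans h2⟩
    · rintro ⟨⟨h1, h2⟩, h3, _⟩
      exact ⟨⟨h3.trans h1, h2⟩, h3, h1⟩

theorem eventually_abs_arraySum_gridArray_sub_lt {z : (Fin 3 → ℝ) → ℝ}
    (hz : ContinuousOn z (Set.Icc 0 1))
    (h0 : ∀ x ∈ Set.Icc (0 : Fin 3 → ℝ) 1, (∃ j, x j = 0) → z x = 0) {δ : ℝ} (hδ : 0 < δ) :
    ∀ᶠ n : Fin 3 → ℕ in atTop, ∀ p ∈ Set.Icc (0 : Fin 3 → ℝ) 1,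
      |arraySum (gridArray n z) n p - z p| < δ := by
  obtain ⟨ρ, hρ, hzρ⟩ := Metric.uniformContinuousOn_iff.1
    (isCompact_Icc.uniformContinuousOn_of_continuous hz) δ hδ
  have hmesh : ∀ᶠ n : Fin 3 → ℕ in atTop, ∀ j, (n j : ℝ)⁻¹ < ρ := by
    rw [eventually_all]
    exact fun j => (tendsto_inv_atTop_nhds_zero_nat.comp
      (tendsto_eval_atTop_pi j)).eventually_lt_const hρ
  filter_upwards [hmesh, eventually_ge_atTop (1 : Fin 3 → ℕ)] with n hnρ hn1 p hp
  have hn : ∀ j, (0 : ℝ) < n j := fun j => by exact_mod_cast Nat.lt_of_lt_of_le one_pos (hn1 j)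
  set k : Fin 3 → ℕ := fun j => ⌊(n j : ℝ) * p j⌋₊ with hk
  have hsum : arraySum (gridArray n z) n p = z (gridPoint n k) := by
    rw [arraySum]
    by_cases hk1 : 1 ≤ k
    · rw [sum_gridArray n z hk1, inv_mul_cancel_left₀]
      exact (Real.sqrt_pos.2 (Finset.prod_pos fun j _ => hn j)).ne'
    -- An index `k j = 0` gives an empty sum; this matches `z` because `z` vanishes on the lower
    -- faces.
    · rw [Finset.Icc_eq_empty hk1, Finset.sum_empty, mul_zero]
      obtain ⟨j, hj⟩ := not_forall.1 hk1
      have hj0 : k j = 0 := Nat.lt_one_iff.1 (not_le.1 hj)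
      exact (h0 _ (gridPoint_mem n k) ⟨j, by simp [gridPoint, hj0]⟩).symm
  rw [hsum]
  refine hzρ _ (gridPoint_mem n k) _ hp ((dist_pi_lt_iff hρ).2 fun j => ?_)
  have h1 : (k j : ℝ) ≤ n j * p j := Nat.floor_le (mul_nonneg (hn j).le (hp.1 j))
  have h2 : (n j : ℝ) * p j < k j + 1 := Nat.lt_floor_add_one _
  have h3 : (k j : ℝ) / n j ≤ p j := (div_le_iff₀' (hn j)).2 h1
  have h4 : p j < k j / n j + (n j : ℝ)⁻¹ := by
    rw [← one_div, ← add_div, lt_div_iff₀' (hn j)]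
    exact h2
  rw [gridPoint, min_eq_left (show _ ≤ (1 : ℝ) from h3.trans (hp.2 j)), Real.dist_eq, abs_lt]
  constructor <;> linarith [hnρ j]

/-! ### The detector statistic in the Skorohod space -/

/-- The signals cancel at the sampling points, so only noise remains. Writing the floor as an
indicator fixes the summation range, so that `u` enters only through the paths of the single
samples. -/
theorem detector_eq_arrayDetector {Ω : Type*} (W : Fin 3 → ℝ) {τ : Fin 3 → ℕ → ℝ}
    {τbar : Fin 3 → ℝ} {f f₀ : (Fin 3 → ℝ) → ℝ} (hH₀ : NullHypothesis f f₀ τ τbar)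
    (e : (Fin 3 → ℤ) → Ω → ℝ) (n : Fin 3 → ℕ) {u : Fin 4 → ℝ} (hu : u 0 ∈ Set.Icc (0 : ℝ) 1)
    (ω : Ω) :
    detector W τ f₀ (observation f e τ) n u ω =
      arrayDetector W τ (fun l => e (fun j => (l j : ℤ)) ω) n u := by
  rw [detector, arrayDetector]
  congr 1
  simp only [mul_ite, mul_zero]
  rw [← Finset.sum_filter]
  have hfloor : ⌊(n 0 : ℝ) * u 0⌋₊ ≤ n 0 := by
    refine (Nat.floor_mono (mul_le_mul_of_nonneg_left hu.2 (Nat.cast_nonneg _))).trans ?_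
    simp
  have hset : Finset.Icc (1 : Fin 3 → ℕ) (Function.update n 0 ⌊(n 0 : ℝ) * u 0⌋₊) =
      (Finset.Icc (1 : Fin 3 → ℕ) n).filter fun l => (l 0 : ℝ) / n 0 ≤ u 0 := by
    ext l
    simp only [Finset.mem_Icc, Finset.mem_filter, le_update_iff, and_assoc]
    refine and_congr_right fun h1 => ?_
    constructor
    · rintro ⟨h2, h3⟩
      have hle : l ≤ n := fun j => if hj : j = 0 then hj ▸ h2.trans hfloor else h3 j hj
      have hn0 : (0 : ℝ) < n 0 := by exact_mod_cast (h1 0).trans (hle 0)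
      exact ⟨hle, (div_le_iff₀' hn0).2 ((Nat.le_floor_iff (mul_nonneg hn0.le hu.1)).1 h2)⟩
    · rintro ⟨h2, h3⟩
      have hn0 : (0 : ℝ) < n 0 := by exact_mod_cast (h1 0).trans (h2 0)
      exact ⟨(Nat.le_floor_iff (mul_nonneg hn0.le hu.1)).2 ((div_le_iff₀' hn0).1 h3),
        fun j _ => h2 j⟩
  rw [← hset]
  refine Finset.sum_congr rfl fun l hl => ?_
  rw [hset] at hl
  rw [observation, hH₀.2 n l (Finset.mem_filter.1 hl).1, add_sub_cancel_left]

section Paths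

variable {a b : Fin 4 → ℝ} (W : Fin 3 → ℝ) (τ : Fin 3 → ℕ → ℝ)

theorem continuous_reconKernel (W : Fin 3 → ℝ) : Continuous (reconKernel W) := by
  unfold reconKernel
  fun_prop

theorem continuous_reconKernel_box (n l : Fin 3 → ℕ) : Continuous fun x : RBox a b =>
    reconKernel W (fun j => RBox.vec x j.succ - samplePoint τ n l j) := by
  refine (continuous_reconKernel W).comp ?_
  unfold RBox.vec
  fun_prop

/-- The path that one sample contributes to the detector statistic. -/
noncomputable def samplePath (n l : Fin 3 → ℕ) (x : RBox a b) : ℝ :=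
  if (l 0 : ℝ) / n 0 ≤ x 0 then
    reconKernel W (fun j => RBox.vec x j.succ - samplePoint τ n l j) else 0

theorem isLamp_samplePath (n l : Fin 3 → ℕ) : IsLamp (samplePath (a := a) (b := b) W τ n l) :=
  IsLamp.indicator (continuous_reconKernel_box W τ n l) 0 _

theorem exists_abs_samplePath_le (n l : Fin 3 → ℕ) :
    ∃ M, ∀ x, |samplePath (a := a) (b := b) W τ n l x| ≤ M := by
  obtain ⟨M, hM⟩ := isCompact_univ.exists_bound_of_continuousOn
    (continuous_reconKernel_box (a := a) (b := b) W τ n l).continuousOn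
  refine ⟨M, fun x => ?_⟩
  have h := hM x trivial
  rw [samplePath]
  split_ifs
  · exact h
  · rw [abs_zero]
    exact (norm_nonneg _).trans h

/-- The path of the detector statistic of an array. -/
noncomputable def detectorPath (n : Fin 3 → ℕ) (e : (Fin 3 → ℕ) → ℝ) : SkorohodSpace a b :=
  SkorohodSpace.linearComb (ι := Finset.Icc (1 : Fin 3 → ℕ) n) (fun l => samplePath W τ n l)
    (fun l => isLamp_samplePath W τ n l) fun l => √(∏ j, τ j (n j)) * e l

theorem detectorPath_apply (n : Fin 3 → ℕ) (e : (Fin 3 → ℕ) → ℝ) (x : RBox a b) :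
    (detectorPath W τ n e).1 x = arrayDetector W τ e n (RBox.vec x) := by
  rw [arrayDetector, Finset.mul_sum, ← Finset.sum_coe_sort]
  refine Finset.sum_congr rfl fun l _ => ?_
  rw [mul_assoc]
  rfl

theorem aemeasurable_detectorPath {Ω : Type*} [MeasurableSpace Ω] {P : Measure Ω}
    (n : Fin 3 → ℕ) {e : Ω → (Fin 3 → ℕ) → ℝ} (he : ∀ l, AEMeasurable (fun ω => e ω l) P) :
    AEMeasurable (fun ω => detectorPath (a := a) (b := b) W τ n (e ω)) P := by
  unfold detectorPath
  exact SkorohodSpace.aemeasurable_linearComb (ι := Finset.Icc (1 : Fin 3 → ℕ) n)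
    (c := fun l ω => √(∏ j, τ j (n j)) * e ω l) _ _ (fun l => exists_abs_samplePath_le W τ n l)
    fun l => (he l).const_mul _

end Paths

theorem RBox.vec_mem {q : ℕ} {a b : Fin q → ℝ} (x : RBox a b) : x.vec ∈ Set.Icc a b :=
  ⟨fun j => (x j).2.1, fun j => (x j).2.2⟩

theorem RBox.continuous_vec {q : ℕ} {a b : Fin q → ℝ} :
    Continuous (RBox.vec : RBox a b → Fin q → ℝ) := by
  unfold RBox.vec
  fun_prop

/-! ### Weak convergence of the detector. -/

theorem mainTheorem1 {Ω Ω' : Type*} [MeasurableSpace Ω] [MeasurableSpace Ω']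
    (P : Measure Ω) [IsProbabilityMeasure P] (P' : Measure Ω') [IsProbabilityMeasure P']
    (e : (Fin 3 → ℤ) → Ω → ℝ) (σ : ℝ) (hσ : 0 < σ)
    (B : (Fin 3 → ℝ) → Ω' → ℝ) (hB : IsBrownianSheet B P') (he : NoiseFCLT e σ B P P')
    (W : Fin 3 → ℝ) (hW : ∀ j, 0 < W j)
    (τ : Fin 3 → ℕ → ℝ) (hτpos : ∀ j m, 1 ≤ m → 0 < τ j m)
    (τbar : Fin 3 → ℝ) (hτ : ∀ j, Tendsto (fun m : ℕ => (m : ℝ) * τ j m) atTop (𝓝 (τbar j)))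
    (s₀ : ℝ) (hs₀ : 0 < s₀) (hs₀' : s₀ < 1)
    (f f₀ : (Fin 3 → ℝ) → ℝ) (hH₀ : NullHypothesis f f₀ τ τbar) :
    (∀ᵐ ω ∂P', ∀ u ∈ Set.Icc (Fin.cons s₀ 0 : Fin 4 → ℝ) (Fin.cons 1 τbar),
      ByPartsIntegrable (limitIntegrand W τbar u) (fun z => B z ω) 0 (upperCorner u)) ∧
    SkorohodWeakConv (Fin.cons s₀ 0 : Fin 4 → ℝ) (Fin.cons 1 τbar)
      (detector W τ f₀ (observation f e τ)) atTop (limitProcess W τbar σ B) P P' := by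
  set Q := Set.Icc (Fin.cons s₀ 0 : Fin 4 → ℝ) (Fin.cons 1 τbar)
  have hQc : IsCompact Q := isCompact_Icc
  have hQ0 : ∀ u ∈ Q, u 0 ∈ Set.Icc (0 : ℝ) 1 := fun u hu =>
    ⟨hs₀.le.trans (hu.1 0), hu.2 0⟩
  have hcube : ∀ u ∈ Q, Set.Icc 0 (upperCorner u) ⊆ Set.Icc (0 : Fin 3 → ℝ) 1 := fun u hu =>
    Set.Icc_subset_Icc_right fun j => (upperCorner_mem (hQ0 u hu) j).2
  refine ⟨?_, ?_⟩
  · filter_upwards [hB.continuousOn] with ω hω u hu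
    exact byPartsIntegrable_limitIntegrand W τbar u
      (fun j => (upperCorner_mem (hQ0 u hu) j).1) (hω.mono (hcube u hu))
  have hlimit : ∀ᵐ ω ∂P', ∀ u ∈ Q, limitProcess W τbar σ B u ω =
      √(∏ j, τbar j) * limitSum W τbar (fun v => σ * B v ω) u := by
    filter_upwards [hB.continuousOn, hB.eq_zero] with ω hω hω0 u hu
    rw [limitProcess, limitSum_const_mul, byPartsIntegral_limitIntegrand W τbar u
      (upperCorner_mem (hQ0 u hu)) (hω.mono (hcube u hu)) fun x hx => hω0 x (hcube u hu hx),
      limitSum, mul_assoc]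
  -- Detectors of arrays built from `B` itself converge uniformly to the limit process; this serves
  -- both `hlamp` and `hVm`.
  have hgrid : ∀ᵐ ω ∂P', ∀ ε > 0, ∀ᶠ n : Fin 3 → ℕ in atTop, ∀ u ∈ Q,
      |arrayDetector W τ (gridArray n fun v => σ * B v ω) n u - limitProcess W τbar σ B u ω|
        ≤ ε := by
    filter_upwards [hB.continuousOn, hB.eq_zero, hlimit] with ω hω hω0 hl ε hε
    have hz : ContinuousOn (fun v => σ * B v ω) (Set.Icc 0 1) := hω.const_mul σ
    obtain ⟨δ, hδ, hev⟩ := eventually_abs_arrayDetector_sub_le W hτ hz hQc hQ0 hε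
    filter_upwards [hev, eventually_abs_arraySum_gridArray_sub_lt hz
      (fun x hx hx0 => by simp [hω0 x hx hx0]) hδ] with n hn hn' u hu
    rw [hl u hu]
    exact hn _ hn' u hu
  have hlamp : ∀ᵐ ω ∂P', IsLamp fun x : RBox (Fin.cons s₀ 0 : Fin 4 → ℝ) (Fin.cons 1 τbar) =>
      limitProcess W τbar σ B x.vec ω := by
    filter_upwards [hgrid] with ω hω
    refine IsLamp.of_uniform_limit fun ε hε => ?_
    obtain ⟨n, hn⟩ := (hω ε hε).exists
    refine ⟨_, (detectorPath W τ n (gridArray n fun v => σ * B v ω)).2, fun x => ?_⟩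
    rw [detectorPath_apply, dist_comm]
    exact hn _ x.vec_mem
  classical
  -- The zero path is a default on a null set.
  let V : Ω' → SkorohodSpace (Fin.cons s₀ 0 : Fin 4 → ℝ) (Fin.cons 1 τbar) := fun ω =>
    if h : IsLamp (fun x : RBox (Fin.cons s₀ 0 : Fin 4 → ℝ) (Fin.cons 1 τbar) =>
      limitProcess W τbar σ B x.vec ω) then ⟨_, h⟩
    else ⟨fun _ => 0, IsLamp.of_continuous continuous_const⟩
  have hV : ∀ᵐ ω ∂P', ∀ x, (V ω).1 x = limitProcess W τbar σ B x.vec ω := by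
    filter_upwards [hlamp] with ω hω x
    have h : V ω = ⟨_, hω⟩ := dif_pos hω
    rw [h]
  have hVm : AEMeasurable V P' := by
    refine aemeasurable_of_tendsto_metrizable_ae (atTop : Filter (Fin 3 → ℕ))
      (f := fun n ω => detectorPath W τ n (gridArray n fun v => σ * B v ω)) (fun n => ?_) ?_
    · refine aemeasurable_detectorPath W τ n fun l => ?_
      refine Finset.aemeasurable_fun_sum _ fun i _ => ?_
      exact (((hB.aemeasurable _ (gridPoint_mem n i)).const_mul σ).const_mul _).mul_const _
    · filter_upwards [hgrid, hV] with ω hω hVω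
      refine EMetric.tendsto_nhds.2 fun ε hε => ?_
      obtain ⟨r, hr, hrε⟩ := ENNReal.lt_iff_exists_nnreal_btwn.1 hε
      filter_upwards [hω r (by simpa using hr)] with n hn
      refine (SkorohodSpace.edist_le_of_forall fun x => ?_).trans_lt hrε
      rw [detectorPath_apply, hVω, edist_nndist, ENNReal.coe_le_coe, ← NNReal.coe_le_coe,
        coe_nndist]
      exact hn _ x.vec_mem
  obtain ⟨X, Z, hX, hZ, hXZ⟩ := he.weakConv
  refine ⟨fun n ω => detectorPath W τ n fun l => e (fun j => (l j : ℤ)) ω, V, fun n ω x => ?_, hV,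
    tendstoInDistribution_of_eventually_mem hXZ (fun n => ?_) hVm ?_⟩
  · rw [detectorPath_apply, detector_eq_arrayDetector W hH₀ e n (hQ0 _ x.vec_mem)]
  · exact aemeasurable_detectorPath W τ n fun l =>
      (he.stationary.memLp _).aestronglyMeasurable.aemeasurable
  · filter_upwards [hB.continuousOn, hZ, hV, hlimit] with ω' hω hZω hVω hl G hG hVG
    obtain ⟨ε, hε, hball⟩ := EMetric.isOpen_iff.1 hG _ hVG
    obtain ⟨r, hr, hrε⟩ := ENNReal.lt_iff_exists_nnreal_btwn.1 hε
    obtain ⟨δ, hδ, hev⟩ := eventually_abs_arrayDetector_sub_le W hτ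
      (hω.const_mul σ) hQc hQ0 (ε := r) (by simpa using hr)
    have hZc : UniformContinuous (Z ω').1 := by
      refine CompactSpace.uniformContinuous_of_continuous ?_
      rw [funext hZω]
      exact (hω.const_mul σ).comp_continuous RBox.continuous_vec RBox.vec_mem
    obtain ⟨η, hη, hηδ⟩ := SkorohodSpace.exists_edist_lt_imp hZc hδ
    -- In this Skorohod ball the partial sum field is uniformly within `δ` of the continuous path `σ
    -- B`, so the pathwise estimate keeps the detector in the ball inside `G`.
    refine ⟨Metric.eball (Z ω') η, Metric.isOpen_eball, Metric.mem_eball_self hη, ?_⟩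
    filter_upwards [hev] with n hn ω hωU
    refine hball ((SkorohodSpace.edist_le_of_forall fun x => ?_).trans_lt hrε)
    rw [detectorPath_apply, hVω, edist_nndist, ENNReal.coe_le_coe, ← NNReal.coe_le_coe,
      coe_nndist, hl _ x.vec_mem]
    refine hn _ (fun p hp => ?_) _ x.vec_mem
    have := hηδ _ hωU fun j => ⟨p j, hp.1 j, hp.2 j⟩
    rw [hX, hZω] at this
    exact this
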